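/- **Setting.** Let $k$ be a field and let $R$ be a discrete valuation ring which is a $k$-algebra, with maximal ideal $XR$ and residue field $R/XR = k$. Let $\alpha$ be a $k$-algebra automorphism of $R$ of infinite order. Let $S = R[\theta;\alpha]$ be the skew polynomial ring, with $\theta r = \alpha(r)\theta$ for $r \in R$, and let $T = S\langle X^{-1}\rangle = Q[\theta;\alpha]$, where $Q$ is the field of fractions of $R$. Extend $\alpha$ to $S$ by $\alpha(\theta)=\theta$. Modules are right modules; $E_T(V)$ is the injective hull of a $T$-module $V$. An element $z$ of $S$ is *irreducible* if it is a nonzero non-unit and $z = ab$ implies that $a$ or $b$ is a unit. An irreducible $z\in S$ has *type (B)* if, up to multiplication by a unit of $R$, $z = 1 + Xs$ with $s \in S \setminus R$; it has *type (C)* if, up to multiplication by a unit of $R$, $z = f + Xs$ with $s \in S$ and $f \in k[\theta]\setminus k$ monic, and $z$ is not $\theta$ up to multiplication by a unit. A simple $S$-module has type (B) if it is isomorphic to $S/zS$ with $z$ irreducible of type (B). A module is *1-critical* if it has (Gabriel–Rentschler) Krull dimension $1$ and all its proper factors have Krull dimension less than $1$. A finitely generated 1-critical $S$-module is of *type (C)*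 if it has a nonzero submodule isomorphic to a submodule of $S/zS$ for some irreducible $z$ of type (C). **Proposition.** Let $\mathcal C = \{1 + Xs : s \in S\}$. 1. $\mathcal C$ is an $\alpha$-invariant (left and right) Ore set in $S$, and whenever $c_1\cdots c_t \in \mathcal C$ with all $c_i \in S$ irreducible, every $c_i$ has type (B). Let now $V$ be a faithful simple $S$-module. Then the $S$-action on $V$ extends to a $T$-module structure, and the following hold. 2. The set $W$ of $\mathcal C$-torsion elements of $E_T(V)$ is a nonzero $T$-submodule of $E_T(V)$. 3. As an $S$-module, $W$ is locally Artinian (every finitely generated submodule is Artinian), and all its composition factors (simple subfactors) have type (B). 4. If $E_T(V)/W$ is nonzero, then: (i) $E_T(V)/W$ is $\mathcal C$-torsion-free, and is an injective $T$-module; (ii) as an $S$-module, $E_T(V)/W$ is injective and is a direct sum of injective hulls of type (C) 1-critical $S$-modules; (iii) every decomposition as in (ii) is also a decomposition of $E_T(V)/W$ as a direct sum of injective hulls of simple $T$-modules. -/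

import Mathlib

universe u v w

open MulOpposite

noncomputable section

/-! ## Skew polynomial rings -/

/-- The action of the free monoid on one generator on `R` through the powers of `α`. -/
abbrev autAction {R : Type u} [CommRing R] (α : R ≃+* R) :
    MulSemiringAction (Multiplicative ℕ) R :=
  MulSemiringAction.compHom R (powersHom (RingAut R) α)

/-- The skew polynomial ring `R[θ; α]`, with coefficients written on the left
and `θ r = α(r) θ`. -/
def SkewPoly {R : Type u} [CommRing R] (_α : R ≃+* R) : Type u := SkewPolynomial R

namespace SkewPoly

variable {R : Type u} [CommRing R] (α : R ≃+* R)

instance : Ring (SkewPoly α) :=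
  letI := autAction α
  inferInstanceAs (Ring (SkewPolynomial R))

/-- The inclusion of the coefficient ring `R` in `R[θ; α]`. -/
def const : R →+* SkewPoly α :=
  letI := autAction α
  (SkewPolynomial.CRingHom : R →+* SkewPolynomial R)

/-- The indeterminate `θ`. -/
def theta : SkewPoly α := (SkewPolynomial.X : SkewPolynomial R)

theorem theta_mul_const (r : R) : theta α * const α r = const α (α r) * theta α := by
  let _ := autAction α
  have h : (SkewPolynomial.X : SkewPolynomial R) * SkewPolynomial.C r
      = SkewPolynomial.C (α r) * SkewPolynomial.X := by
    rw [SkewPolynomial.C_mul_X_eq_monomial, ← SkewPolynomial.monomial_zero_left,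
      SkewPolynomial.X_mul_monomial]
    rfl
  exact h

variable {α} in
/-- The universal property: a ring homomorphism `f : R → A` and an element `t` of `A` with
`t f(r) = f(α(r)) t` define the ring homomorphism `∑ rᵢ θⁱ ↦ ∑ f(rᵢ) tⁱ`. -/
def lift {A : Type v} [Ring A] (f : R →+* A) (t : A) (h : ∀ r, t * f r = f (α r) * t) :
    SkewPoly α →+* A :=
  letI := autAction α
  SkewMonoidAlgebra.liftNCRingHom (k := R) (G := Multiplicative ℕ) f (powersHom A t) (by
    intro x y
    have key : ∀ (n : ℕ) (x : R), f ((α : RingAut R) ^ n • x) * t ^ n = t ^ n * f x := by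
      intro n
      induction n with
      | zero => intro x; simp
      | succ n ih =>
        intro x
        rw [pow_succ, pow_succ (t : A), mul_smul, ← mul_assoc, ih, mul_assoc, mul_assoc, h]
        rfl
    exact key _ x)

variable {α} in
/-- The coefficientwise extension of a ring homomorphism that commutes with the automorphisms. -/
def map {R' : Type v} [CommRing R'] (α' : R' ≃+* R') (f : R →+* R')
    (h : ∀ r, f (α r) = α' (f r)) : SkewPoly α →+* SkewPoly α' :=
  lift ((const α').comp f) (theta α') (fun r => by
    simp only [RingHom.comp_apply, theta_mul_const, h])

end SkewPoly

/-! ## General module theory, over a ring `A` (right modules are modules over `Aᵐᵒᵖ`) -/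

/-- Restriction of scalars along a ring homomorphism `f : A → B`: the same additive group. -/
def Restrict {A : Type u} {B : Type v} [Ring A] [Ring B] (_f : A →+* B) (M : Type w) : Type w := M

namespace Restrict

variable {A : Type u} {B : Type v} [Ring A] [Ring B] (f : A →+* B) (M : Type w) [AddCommGroup M]

instance : AddCommGroup (Restrict f M) := inferInstanceAs (AddCommGroup M)

instance [Module B M] : Module A (Restrict f M) := Module.compHom M f

/-- The identity map, from `M` to its restriction of scalars. -/
def of : M ≃+ Restrict f M := AddEquiv.refl M

end Restrict

/-- `DevLT n a b`: the deviation of the interval `[a, b]` of the poset `P` is less than `n`.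
Deviation less than `0` means that the interval is trivial; deviation less than `n + 1` means that
in every descending chain in the interval all but finitely many of the factors
have deviation less than `n`. -/
def DevLT {P : Type u} [PartialOrder P] : ℕ → P → P → Prop
  | 0, a, b => a = b
  | n + 1, a, b => ∀ c : ℕ → P, Antitone c → (∀ i, a ≤ c i ∧ c i ≤ b) →
      ∃ m, ∀ i, m ≤ i → DevLT n (c (i + 1)) (c i)

section Modules

variable (A : Type u) [Ring A]

/-- The (Gabriel-Rentschler) Krull dimension of `M`, the deviation of its lattice of submodules,
is less than `n`. -/
def KdimLT (n : ℕ) (M : Type v) [AddCommGroup M] [Module A M] : Prop :=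
  DevLT n (⊥ : Submodule A M) ⊤

/-- `M` is `n`-critical: its Krull dimension is `n`, and every proper factor has
Krull dimension less than `n`. -/
def IsCriticalModule (n : ℕ) (M : Type v) [AddCommGroup M] [Module A M] : Prop :=
  KdimLT A (n + 1) M ∧ ¬ KdimLT A n M ∧ ∀ N : Submodule A M, N ≠ ⊥ → KdimLT A n (M ⧸ N)

/-- `M` and `N` are hull-similar: they have isomorphic nonzero submodules. -/
def HullSimilar (M : Type v) (N : Type w) [AddCommGroup M] [Module A M]
    [AddCommGroup N] [Module A N] : Prop :=
  ∃ (M' : Submodule A M) (N' : Submodule A N), M' ≠ ⊥ ∧ Nonempty (M' ≃ₗ[A] N')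

/-- Every finitely generated submodule is Artinian. -/
def IsLocallyArtinian (M : Type v) [AddCommGroup M] [Module A M] : Prop :=
  ∀ N : Submodule A M, N.FG → IsArtinian A N

/-- `j : M → E` is an injective hull of `M`: an embedding in an injective module
with essential image. -/
def IsInjectiveHull {M : Type v} {E : Type w} [AddCommGroup M] [Module A M]
    [AddCommGroup E] [Module A E] (j : M →ₗ[A] E) : Prop :=
  Module.Injective A E ∧ Function.Injective j ∧
    ∀ N : Submodule A E, N ⊓ LinearMap.range j = ⊥ → N = ⊥

variable {A}

/-- `M` is the internal direct sum of the family `N` of submodules. -/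
def IsDirectSumOf {M : Type v} [AddCommGroup M] [Module A M] {ι : Type w}
    (N : ι → Submodule A M) : Prop :=
  iSupIndep N ∧ ⨆ i, N i = ⊤

end Modules

/-! ## The rings `S = R[θ; α]` and `T = Q[θ; α]`, with `Q` the field of fractions of `R` -/

section Setting

variable {k : Type v} [Field k] {R : Type u} [CommRing R] [IsDomain R] [Algebra k R]
variable (α : R ≃ₐ[k] R)

/-- `S = R[θ; α]`. -/
abbrev RingS : Type u := SkewPoly (α : R ≃+* R)

/-- The extension of `α` to the field of fractions `Q` of `R`. -/
def fracAut : FractionRing R ≃+* FractionRing R :=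
  IsFractionRing.ringEquivOfRingEquiv (α : R ≃+* R)

/-- `T = Q[θ; α]`, which is `S` with `X` inverted. -/
abbrev RingT : Type u := SkewPoly (fracAut α)

/-- The inclusion of `S` in `T`. -/
def inclST : RingS α →+* RingT α :=
  SkewPoly.map (fracAut α) (algebraMap R (FractionRing R)) (fun r => by
    simp [fracAut])

/-- The extension of `α` to `S`, fixing `θ`. -/
def autS : RingS α →+* RingS α :=
  SkewPoly.map (α : R ≃+* R) ((α : R ≃+* R) : R →+* R) (fun _ => rfl)

/-- A right `T`-module, regarded as a right `S`-module. -/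
abbrev AsS (M : Type w) : Type w := Restrict (RingHom.op (inclST α)) M

/-- The right `T`-module structure of `V` extends its right `S`-module structure. -/
def ExtendsAction (V : Type w) [AddCommGroup V] [Module (RingS α)ᵐᵒᵖ V]
    [Module (RingT α)ᵐᵒᵖ V] : Prop :=
  ∀ (s : RingS α) (x : V), op (inclST α s) • x = op s • x

/-- The right `S`-module `S/zS`. -/
abbrev cyclicS (z : RingS α) : Type u :=
  RingS α ⧸ (Submodule.span (RingS α)ᵐᵒᵖ {z} : Submodule (RingS α)ᵐᵒᵖ (RingS α))

/-- A polynomial `∑ aᵢ θⁱ` over `k`, as an element of `S`. -/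
def polyS (f : Polynomial k) : RingS α :=
  f.sum fun i a => SkewPoly.const (α : R ≃+* R) (algebraMap k R a) * SkewPoly.theta (α : R ≃+* R) ^ i

variable (X : R)

/-- The set `𝒞 = {1 + X s : s ∈ S}`. -/
def setC : Set (RingS α) := {c | ∃ s : RingS α, c = 1 + SkewPoly.const (α : R ≃+* R) X * s}

/-- Irreducible elements of type (B): up to a unit factor, `1 + X s` with `s ∈ S \ R`. -/
def IsTypeB (z : RingS α) : Prop :=
  Irreducible z ∧ ∃ (e : Rˣ) (s : RingS α), s ∉ Set.range (SkewPoly.const (α : R ≃+* R)) ∧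
    SkewPoly.const (α : R ≃+* R) e * z = 1 + SkewPoly.const (α : R ≃+* R) X * s

/-- Irreducible elements of type (C): up to a unit factor, `f + X s` with `f ∈ k[θ] \ k` monic
and `s ∈ S`, but not `θ` up to a unit factor. -/
def IsTypeC (z : RingS α) : Prop :=
  Irreducible z ∧
    (∃ (e : Rˣ) (f : Polynomial k) (s : RingS α), f.Monic ∧ 0 < f.natDegree ∧
      SkewPoly.const (α : R ≃+* R) e * z = polyS α f + SkewPoly.const (α : R ≃+* R) X * s) ∧
    ∀ e : Rˣ, SkewPoly.const (α : R ≃+* R) e * z ≠ SkewPoly.theta (α : R ≃+* R)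

/-- Modules of type (B): those isomorphic to `S/zS` with `z` irreducible of type (B). -/
def IsTypeBModule (M : Type w) [AddCommGroup M] [Module (RingS α)ᵐᵒᵖ M] : Prop :=
  ∃ z : RingS α, IsTypeB α X z ∧ Nonempty (M ≃ₗ[(RingS α)ᵐᵒᵖ] cyclicS α z)

/-- Type (C) 1-critical modules: the finitely generated 1-critical modules that are hull-similar
to `S/zS` with `z` irreducible of type (C). -/
def IsTypeCCritical (M : Type w) [AddCommGroup M] [Module (RingS α)ᵐᵒᵖ M] : Prop :=
  Module.Finite (RingS α)ᵐᵒᵖ M ∧ IsCriticalModule (RingS α)ᵐᵒᵖ 1 M ∧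
    ∃ z : RingS α, IsTypeC α X z ∧ HullSimilar (RingS α)ᵐᵒᵖ M (cyclicS α z)

/-- `M` is the direct sum of the family `N` of submodules, each of which is an injective hull
of a type (C) 1-critical module. -/
def IsTypeCDecomposition {M : Type w} [AddCommGroup M] [Module (RingS α)ᵐᵒᵖ M] {ι : Type w}
    (N : ι → Submodule (RingS α)ᵐᵒᵖ M) : Prop :=
  IsDirectSumOf N ∧ ∀ i, ∃ U : Submodule (RingS α)ᵐᵒᵖ (N i),
    IsTypeCCritical α X U ∧ IsInjectiveHull (RingS α)ᵐᵒᵖ (M := U) (E := N i) U.subtype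

end Setting

/-- `M` is the direct sum of the family `N` of submodules, each of which is an injective hull
of a simple module. -/
def IsSimpleHullDecomposition {A : Type u} [Ring A] {M : Type w} [AddCommGroup M] [Module A M]
    {ι : Type w} (N : ι → Submodule A M) : Prop :=
  IsDirectSumOf N ∧ ∀ i, ∃ U : Submodule A (N i), IsSimpleModule A U ∧ IsInjectiveHull A U.subtype

end

/-! Right modules are treated as left modules over opposite rings; in the general lemmas `A`, `B`,
`ι`, `π`, `x` stand for `S`, `T`, the inclusion, reduction modulo `X`, and `X`. As `α` is trivial on
the residue field, `X` is a normal element and `S/XS` is the commutative domain `k[θ]`. Thus `𝒞` is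
the fibre of `π` over `1`: factors of its elements are units modulo `X`, and the Ore condition
follows from an Artin-Rees type argument (`exists_mul_eq_mul_of_normal`). Inverting `X` gives `T`, a
principal right ideal domain in which chains of right ideals above a nonzero element stabilize
(`chainsStabilize_ringT`).

On a faithful simple `V`, normality makes `X` bijective, so `V` is a `T`-module (`exists_module`),
and each vector is killed by some element of `𝒞`. On a `𝒞`-torsion `T`-module, `X⁻¹` acts on each
element through `S` (`exists_smul_eq_of_torsion`), so `S`-submodules behave like `T`-submodules and
finitely generated ones are Artinian. A simple `𝒞`-torsion module is `S/zS` with `z` irreducible and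
a unit modulo `X`, hence of type (B).

`E` is divisible and, by essentiality over `V`, torsion over `T`; both properties pass to `E/W`.
Over a principal ideal domain divisibility gives injectivity, and over `S` it does so too because
`X` acts injectively (`injective_of_divisible`). Zorn's lemma splits `E/W` into hulls of simple
`T`-modules (`exists_decomposition`). In such a hull a generator `m` of the simple module has
annihilator generated by an irreducible `z` that is neither zero nor a unit modulo `X`, since there
is no `𝒞`-torsion, and is not `θ` up to a unit, since `θ` acts injectively. Hence `mS` is 1-critical
of type (C) and its hull is the same module (`exists_isTypeCCritical`). Conversely, `S`-injective
submodules are closed under `X⁻¹`, and uniformity of 1-critical modules makes them hulls of simple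
`T`-modules (`exists_isSimpleHullDecomposition`). -/

noncomputable section

/-! ### Coefficients and degree of skew polynomials. -/

namespace SkewPoly

section Coefficients

variable {R : Type u} [CommRing R] {α : R ≃+* R}

/-- The sequence of coefficients of a skew polynomial. -/
def coeff : SkewPoly α →+ (ℕ → R) where
  toFun f n := SkewPolynomial.coeff (R := R) f n
  map_zero' := rfl
  map_add' f g := by
    funext n
    exact SkewPolynomial.coeff_add (R := R) f g n

theorem const_mul_theta_pow (r : R) (n : ℕ) :
    const α r * theta α ^ n = (SkewPolynomial.monomial n r : SkewPolynomial R) := by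
  let _ := autAction α
  have h := SkewPolynomial.C_mul_X_pow_eq_monomial (R := R) (a := r) (n := n)
  exact h

theorem coeff_const_mul_theta_pow (r : R) (n m : ℕ) :
    coeff (const α r * theta α ^ n) m = if n = m then r else 0 := by
  rw [const_mul_theta_pow]
  exact SkewPolynomial.coeff_monomial

theorem ext {f g : SkewPoly α} (h : ∀ n, coeff f n = coeff g n) : f = g :=
  SkewPolynomial.ext (R := R) h

theorem induction {P : SkewPoly α → Prop} (h0 : P 0)
    (hm : ∀ (r : R) (n : ℕ), P (const α r * theta α ^ n))
    (ha : ∀ f g, P f → P g → P (f + g)) (f : SkewPoly α) : P f := by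
  refine SkewPolynomial.induction (R := R) (motive := P) f h0 fun n r q _ _ hq => ?_
  have := ha _ _ (hm r n) hq
  rwa [const_mul_theta_pow] at this

theorem coeff_const (r : R) (m : ℕ) : coeff (const α r) m = if 0 = m then r else 0 := by
  simpa using coeff_const_mul_theta_pow (α := α) r 0 m

theorem theta_pow_mul_const (n : ℕ) (r : R) :
    theta α ^ n * const α r = const α (α^[n] r) * theta α ^ n := by
  induction n generalizing r with
  | zero => simp
  | succ n ih =>
    rw [pow_succ, mul_assoc, theta_mul_const, ← mul_assoc, ih, Function.iterate_succ_apply,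
      mul_assoc]

theorem monomial_mul_monomial (a b : R) (i j : ℕ) :
    (const α a * theta α ^ i) * (const α b * theta α ^ j) =
      const α (a * α^[i] b) * theta α ^ (i + j) := by
  rw [mul_assoc, ← mul_assoc (theta α ^ i), theta_pow_mul_const, map_mul, pow_add]
  simp only [mul_assoc]

theorem coeff_mul (f g : SkewPoly α) (n : ℕ) :
    coeff (f * g) n =
      ∑ p ∈ Finset.HasAntidiagonal.antidiagonal n, coeff f p.1 * α^[p.1] (coeff g p.2) := by
  induction f using induction with
  | h0 => simp
  | ha f₁ f₂ h₁ h₂ => simp [add_mul, h₁, h₂, Finset.sum_add_distrib]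
  | hm a i =>
    induction g using induction with
    | h0 => simp [iterate_map_zero]
    | ha g₁ g₂ h₁ h₂ => simp [mul_add, h₁, h₂, Finset.sum_add_distrib, iterate_map_add]
    | hm b j =>
      rw [monomial_mul_monomial, coeff_const_mul_theta_pow]
      simp only [coeff_const_mul_theta_pow]
      split_ifs with h
      · rw [Finset.sum_eq_single (i, j)]
        · simp
        · rintro ⟨p, q⟩ hp hne
          by_cases hpi : i = p
          · subst hpi
            have hqj : j ≠ q := fun hq => hne (by simp [hq])
            simp [hqj, iterate_map_zero]
          · simp [hpi]
        · intro hij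
          exact absurd (Finset.HasAntidiagonal.mem_antidiagonal.2 h) hij
      · symm
        apply Finset.sum_eq_zero
        rintro ⟨p, q⟩ hp
        rw [Finset.HasAntidiagonal.mem_antidiagonal] at hp
        by_cases hpi : i = p
        · subst hpi
          have hqj : j ≠ q := fun hq => h (by rw [hq]; exact hp)
          simp [hqj, iterate_map_zero]
        · simp [hpi]

theorem coeff_const_mul (r : R) (f : SkewPoly α) (n : ℕ) :
    coeff (const α r * f) n = r * coeff f n := by
  rw [coeff_mul, Finset.sum_eq_single (0, n)]
  · simp [coeff_const]
  · rintro ⟨p, q⟩ hp hne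
    have : 0 ≠ p := by
      rintro rfl
      exact hne (by simpa using hp)
    simp [coeff_const, this]
  · simp

theorem coeff_mul_const (r : R) (f : SkewPoly α) (n : ℕ) :
    coeff (f * const α r) n = coeff f n * α^[n] r := by
  rw [coeff_mul, Finset.sum_eq_single (n, 0)]
  · simp [coeff_const]
  · rintro ⟨p, q⟩ hp hne
    have : 0 ≠ q := by
      rintro rfl
      exact hne (by simpa using hp)
    simp [coeff_const, this, iterate_map_zero]
  · simp

/-- The degree of `f` is less than `n`. -/
def DegLT (f : SkewPoly α) (n : ℕ) : Prop := ∀ m, n ≤ m → coeff f m = 0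

theorem exists_degLT (f : SkewPoly α) : ∃ n, DegLT f n := by
  induction f using induction with
  | h0 => exact ⟨0, fun m _ => by simp⟩
  | hm r n =>
    refine ⟨n + 1, fun m hm => ?_⟩
    rw [coeff_const_mul_theta_pow, if_neg (by lia)]
  | ha f g hf hg =>
    obtain ⟨a, ha⟩ := hf
    obtain ⟨b, hb⟩ := hg
    refine ⟨max a b, fun m hm => ?_⟩
    rw [map_add, Pi.add_apply, ha m (le_of_max_le_left hm), hb m (le_of_max_le_right hm), add_zero]

open Classical in
/-- The least `n` such that `f` has degree less than `n`; it is `0` for `f = 0`. -/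
def size (f : SkewPoly α) : ℕ := Nat.find (exists_degLT f)

theorem degLT_size (f : SkewPoly α) : DegLT f (size f) := by
  classical exact Nat.find_spec (exists_degLT f)

theorem size_le {f : SkewPoly α} {n : ℕ} (h : DegLT f n) : size f ≤ n := by
  classical exact Nat.find_min' (exists_degLT f) h

theorem eq_zero_of_degLT_zero {f : SkewPoly α} (h : DegLT f 0) : f = 0 :=
  ext fun n => by rw [h n n.zero_le]; simp

theorem exists_size_eq {f : SkewPoly α} (hf : f ≠ 0) :
    ∃ d, size f = d + 1 ∧ coeff f d ≠ 0 := by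
  obtain ⟨d, hd⟩ : ∃ d, size f = d + 1 := by
    refine Nat.exists_eq_succ_of_ne_zero fun h => hf (eq_zero_of_degLT_zero ?_)
    rw [← h]
    exact degLT_size f
  refine ⟨d, hd, fun h0 => ?_⟩
  have : size f ≤ d := size_le fun m hm => by
    rcases hm.eq_or_lt with rfl | hlt
    · exact h0
    · exact degLT_size f m (by lia)
  lia

theorem degLT_mul {f g : SkewPoly α} {m n : ℕ} (hf : DegLT f (m + 1)) (hg : DegLT g (n + 1)) :
    DegLT (f * g) (m + n + 1) := by
  intro i hi
  rw [coeff_mul]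
  apply Finset.sum_eq_zero
  rintro ⟨p, q⟩ hp
  rw [Finset.HasAntidiagonal.mem_antidiagonal] at hp
  by_cases hpm : m + 1 ≤ p
  · simp [hf p hpm]
  · have : coeff g q = 0 := hg q (by simp only at hp; lia)
    simp [this, iterate_map_zero]

theorem coeff_mul_top {f g : SkewPoly α} {m n : ℕ} (hf : DegLT f (m + 1)) (hg : DegLT g (n + 1)) :
    coeff (f * g) (m + n) = coeff f m * α^[m] (coeff g n) := by
  rw [coeff_mul, Finset.sum_eq_single (m, n)]
  · rintro ⟨p, q⟩ hp hne
    rw [Finset.HasAntidiagonal.mem_antidiagonal] at hp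
    by_cases hpm : m + 1 ≤ p
    · simp [hf p hpm]
    · have : coeff g q = 0 := hg q (by
        simp only at hp
        by_contra hq
        exact hne (by ext <;> simp only <;> lia))
      simp [this, iterate_map_zero]
  · simp

theorem iterate_ne_zero {r : R} (hr : r ≠ 0) (n : ℕ) : α^[n] r ≠ 0 := fun h =>
  hr (α.injective.iterate n (by rw [h, iterate_map_zero]))

/-- `size` is the degree plus one, hence the shift. The leading coefficient of the product is
nonzero because `α` is injective and `R` is a domain. -/
theorem size_mul [IsDomain R] {f g : SkewPoly α} (hf : f ≠ 0) (hg : g ≠ 0) :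
    f * g ≠ 0 ∧ size (f * g) + 1 = size f + size g := by
  obtain ⟨m, hm, hfm⟩ := exists_size_eq hf
  obtain ⟨n, hn, hgn⟩ := exists_size_eq hg
  have hf' : DegLT f (m + 1) := hm ▸ degLT_size f
  have hg' : DegLT g (n + 1) := hn ▸ degLT_size g
  have hc : coeff (f * g) (m + n) ≠ 0 := by
    rw [coeff_mul_top hf' hg']
    exact mul_ne_zero hfm (iterate_ne_zero hgn m)
  refine ⟨fun h => hc (by simp [h]), ?_⟩
  have h1 := size_le (degLT_mul hf' hg')
  have h2 : m + n < size (f * g) := by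
    by_contra h
    exact hc (degLT_size _ _ (by lia))
  lia

instance [IsDomain R] : NoZeroDivisors (SkewPoly α) where
  eq_zero_or_eq_zero_of_mul_eq_zero {f g} h := by
    by_contra! hne
    exact (size_mul hne.1 hne.2).1 h

instance [Nontrivial R] : Nontrivial (SkewPoly α) :=
  ⟨0, 1, fun h => by
    have := congrFun (congrArg coeff h) 0
    rw [← map_one (const α), coeff_const] at this
    simp at this⟩

instance [IsDomain R] : IsDomain (SkewPoly α) := NoZeroDivisors.to_isDomain _

theorem lift_const_mul_theta_pow {A : Type v} [Ring A] (f : R →+* A) (t : A)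
    (h : ∀ r, t * f r = f (α r) * t) (r : R) (n : ℕ) :
    lift f t h (const α r * theta α ^ n) = f r * t ^ n := by
  let _ := autAction α
  rw [const_mul_theta_pow]
  exact SkewMonoidAlgebra.liftNC_single _ _ _ _

theorem lift_const {A : Type v} [Ring A] (f : R →+* A) (t : A)
    (h : ∀ r, t * f r = f (α r) * t) (r : R) : lift f t h (const α r) = f r := by
  simpa using lift_const_mul_theta_pow f t h r 0

theorem lift_theta {A : Type v} [Ring A] (f : R →+* A) (t : A)
    (h : ∀ r, t * f r = f (α r) * t) : lift f t h (theta α) = t := by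
  simpa using lift_const_mul_theta_pow f t h 1 1

theorem coeff_map {R' : Type v} [CommRing R'] {α' : R' ≃+* R'} (f : R →+* R')
    (h : ∀ r, f (α r) = α' (f r)) (p : SkewPoly α) (n : ℕ) :
    coeff (map α' f h p) n = f (coeff p n) := by
  induction p using induction with
  | h0 => simp
  | ha p q hp hq => simp [hp, hq]
  | hm r i =>
    rw [map, lift_const_mul_theta_pow, RingHom.comp_apply, coeff_const_mul_theta_pow,
      coeff_const_mul_theta_pow, apply_ite f, map_zero]

theorem map_injective {R' : Type v} [CommRing R'] {α' : R' ≃+* R'} (f : R →+* R')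
    (h : ∀ r, f (α r) = α' (f r)) (hf : Function.Injective f) :
    Function.Injective (map α' f h) := fun p q hpq => ext fun n => hf (by
  rw [← coeff_map (α' := α') f h, hpq, coeff_map])

theorem exists_mul_theta (f : SkewPoly α) : ∃ g, f * theta α = theta α * g := by
  induction f using induction with
  | h0 => exact ⟨0, by simp⟩
  | ha p q hp hq =>
    obtain ⟨a, ha⟩ := hp
    obtain ⟨b, hb⟩ := hq
    exact ⟨a + b, by rw [add_mul, ha, hb, mul_add]⟩
  | hm r n =>
    refine ⟨const α (α.symm r) * theta α ^ n, ?_⟩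
    rw [← mul_assoc, theta_mul_const, α.apply_symm_apply, mul_assoc, mul_assoc, ← pow_succ,
      pow_succ']

theorem exists_theta_mul (f : SkewPoly α) : ∃ g, theta α * f = g * theta α := by
  induction f using induction with
  | h0 => exact ⟨0, by simp⟩
  | ha p q hp hq =>
    obtain ⟨a, ha⟩ := hp
    obtain ⟨b, hb⟩ := hq
    exact ⟨a + b, by rw [mul_add, ha, hb, add_mul]⟩
  | hm r n =>
    refine ⟨const α (α r) * theta α ^ n, ?_⟩
    rw [← mul_assoc, theta_mul_const, mul_assoc, mul_assoc, ← pow_succ, pow_succ']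

theorem theta_ne_zero [Nontrivial R] : theta α ≠ 0 := fun h => by
  have := coeff_const_mul_theta_pow (α := α) 1 1 1
  rw [pow_one, h] at this
  simp at this

theorem mem_range_const_of_size_eq_one {f : SkewPoly α} (h : size f = 1) :
    f = const α (coeff f 0) := ext fun n => by
  rw [coeff_const]
  split_ifs with hn
  · rw [hn]
  · exact degLT_size f n (by lia)

end Coefficients

/-! ### Division with remainder over a field. -/

section Field

variable {K : Type u} [Field K] {α : K ≃+* K}

theorem isUnit_of_size_eq_one {f : SkewPoly α} (h : size f = 1) : IsUnit f := by
  have hf := mem_range_const_of_size_eq_one h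
  have h0 : coeff f 0 ≠ 0 := fun h0 => by
    have : size f ≤ 0 := size_le (by rw [hf, h0]; intro m _; simp)
    lia
  rw [hf]
  exact h0.isUnit.map (const α)

theorem iterate_surjective (α : K ≃+* K) (n : ℕ) : Function.Surjective (α^[n]) :=
  α.surjective.iterate n

/-- One step of the division by `g`, with the quotient on the right. -/
theorem exists_degLT_sub_mul {f g : SkewPoly α} (hg : g ≠ 0) {n : ℕ} (hn : size g ≤ n + 1)
    (hf : DegLT f (n + 1)) : ∃ q, DegLT (f - g * q) n := by
  obtain ⟨d, hd, hgd⟩ := exists_size_eq hg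
  -- With the quotient on the right, `c` reaches the leading coefficient only as `α^d(c)`, so
  -- surjectivity of `α^d` is needed.
  obtain ⟨c, hc⟩ := iterate_surjective α d (coeff f n / coeff g d)
  obtain ⟨e, rfl⟩ : ∃ e, n = d + e := ⟨n - d, by lia⟩
  have hq : DegLT (const α c * theta α ^ e) (e + 1) := fun m hm => by
    rw [coeff_const_mul_theta_pow, if_neg (by lia)]
  have hgd' : DegLT g (d + 1) := hd ▸ degLT_size g
  refine ⟨const α c * theta α ^ e, fun m hm => ?_⟩
  rw [map_sub, Pi.sub_apply]
  rcases hm.eq_or_lt with rfl | hlt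
  · rw [coeff_mul_top hgd' hq, coeff_const_mul_theta_pow, if_pos rfl, hc,
      mul_div_cancel₀ _ hgd, sub_self]
  · rw [hf m hlt, degLT_mul hgd' hq m hlt, sub_self]

/-- Left ideals of the opposite ring are right ideals, so division with the quotient on the right
shows that an element of least size generates. -/
instance : IsPrincipalIdealRing (SkewPoly α)ᵐᵒᵖ where
  principal I := by
    classical
    by_cases hI : I = ⊥
    · rw [hI]
      infer_instance
    obtain ⟨x, hxI, hx⟩ := Submodule.exists_mem_ne_zero_of_ne_bot hI
    have hex : ∃ n, ∃ g : SkewPoly α, op g ∈ I ∧ g ≠ 0 ∧ size g = n :=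
      ⟨_, unop x, hxI, by simpa using hx, rfl⟩
    obtain ⟨g, hgI, hg, hgn⟩ := Nat.find_spec hex
    have key : ∀ (n : ℕ) (f : SkewPoly α), op f ∈ I → DegLT f n →
        op f ∈ Submodule.span (SkewPoly α)ᵐᵒᵖ {op g} := by
      intro n
      induction n with
      | zero =>
        intro f _ hf
        rw [eq_zero_of_degLT_zero hf]
        exact Submodule.zero_mem _
      | succ n ih =>
        intro f hfI hf
        by_cases hn : size g ≤ n + 1
        · obtain ⟨q, hq⟩ := exists_degLT_sub_mul hg hn hf
          have hmem : op (g * q) ∈ Submodule.span (SkewPoly α)ᵐᵒᵖ {op g} :=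
            Submodule.mem_span_singleton.2 ⟨op q, rfl⟩
          have hmemI : op (g * q) ∈ I := I.mul_mem_left (op q) hgI
          have := ih (f - g * q) (by rw [op_sub]; exact I.sub_mem hfI hmemI) hq
          rw [op_sub] at this
          simpa using Submodule.add_mem _ this hmem
        · have hfz : f = 0 := by
            by_contra hf0
            have := Nat.find_min' hex ⟨f, hfI, hf0, rfl⟩
            have := size_le hf
            lia
          rw [hfz]
          exact Submodule.zero_mem _
    refine ⟨op g, le_antisymm (fun f hf => ?_) ?_⟩
    · exact key _ (unop f) hf (degLT_size _)
    · rw [Submodule.span_le, Set.singleton_subset_iff]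
      exact hgI

end Field

end SkewPoly

/-! ### Hilbert's basis theorem in a twisted setting. -/

section HilbertBasis

variable {R : Type u} [CommRing R] {A : Type v} [Ring A] (i : R →+* A) (t : A)

/-- The sums of terms `tʲ r` with `j < n`. -/
def lowTerms (n : ℕ) : AddSubgroup A :=
  AddSubgroup.closure {a | ∃ j < n, ∃ r, a = t ^ j * i r}

variable {i t}

theorem lowTerms_mono {m n : ℕ} (h : m ≤ n) : lowTerms i t m ≤ lowTerms i t n :=
  AddSubgroup.closure_mono fun _ ⟨j, hj, r, hr⟩ => ⟨j, hj.trans_le h, r, hr⟩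

theorem lowTerms_zero {a : A} (ha : a ∈ lowTerms i t 0) : a = 0 := by
  have : {a : A | ∃ j < 0, ∃ r, a = t ^ j * i r} = ∅ := by
    ext a
    simp
  rw [lowTerms, this, AddSubgroup.closure_empty] at ha
  exact ha

theorem exists_of_mem_lowTerms_succ {n : ℕ} {a : A} (ha : a ∈ lowTerms i t (n + 1)) :
    ∃ r, a - t ^ n * i r ∈ lowTerms i t n := by
  induction ha using AddSubgroup.closure_induction with
  | mem a ha =>
    obtain ⟨j, hj, r, rfl⟩ := ha
    rcases (Nat.lt_succ_iff.1 hj).eq_or_lt with rfl | hlt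
    · exact ⟨r, by simp [zero_mem]⟩
    · refine ⟨0, ?_⟩
      rw [map_zero, mul_zero, sub_zero]
      exact AddSubgroup.subset_closure ⟨j, hlt, r, rfl⟩
  | zero => exact ⟨0, by simp [zero_mem]⟩
  | add a b _ _ ha hb =>
    obtain ⟨r, hr⟩ := ha
    obtain ⟨s, hs⟩ := hb
    refine ⟨r + s, ?_⟩
    convert add_mem hr hs using 1
    rw [map_add, mul_add]
    abel
  | neg a _ ha =>
    obtain ⟨r, hr⟩ := ha
    refine ⟨-r, ?_⟩
    convert neg_mem hr using 1
    rw [map_neg, mul_neg]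
    abel

theorem mul_pow_twist {β : R → R} (hβ : ∀ r, i r * t = t * i (β r)) (r : R) (n : ℕ) :
    i r * t ^ n = t ^ n * i (β^[n] r) := by
  induction n generalizing r with
  | zero => simp
  | succ n ih =>
    rw [pow_succ', ← mul_assoc, hβ, mul_assoc, ih, ← mul_assoc, Function.iterate_succ_apply]

theorem coeff_mul_mem_lowTerms {β : R → R} (hβ : ∀ r, i r * t = t * i (β r)) (r : R) {n : ℕ}
    {a : A} (ha : a ∈ lowTerms i t n) : i r * a ∈ lowTerms i t n := by
  induction ha using AddSubgroup.closure_induction with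
  | mem a ha =>
    obtain ⟨j, hj, s, rfl⟩ := ha
    refine AddSubgroup.subset_closure ⟨j, hj, β^[j] r * s, ?_⟩
    rw [← mul_assoc, mul_pow_twist hβ, map_mul, mul_assoc]
  | zero => simp [zero_mem]
  | add a b _ _ ha hb => rw [mul_add]; exact add_mem ha hb
  | neg a _ ha => rw [mul_neg]; exact neg_mem ha

theorem mul_mem_lowTerms_succ {n : ℕ} {a : A} (ha : a ∈ lowTerms i t n) :
    t * a ∈ lowTerms i t (n + 1) := by
  induction ha using AddSubgroup.closure_induction with
  | mem a ha =>
    obtain ⟨j, hj, s, rfl⟩ := ha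
    refine AddSubgroup.subset_closure ⟨j + 1, by lia, s, ?_⟩
    rw [pow_succ', mul_assoc]
  | zero => simp [zero_mem]
  | add a b _ _ ha hb => rw [mul_add]; exact add_mem ha hb
  | neg a _ ha => rw [mul_neg]; exact neg_mem ha

/-- The ideal of the leading coefficients of the elements of degree `n` of a left ideal. -/
def leadingIdeal {β : R → R} (hβ : ∀ r, i r * t = t * i (β r)) (hs : Function.Surjective β)
    (I : Ideal A) (n : ℕ) : Ideal R where
  carrier := {r | ∃ a ∈ I, a - t ^ n * i r ∈ lowTerms i t n}
  zero_mem' := ⟨0, I.zero_mem, by simp [zero_mem]⟩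
  add_mem' := by
    rintro r s ⟨a, ha, har⟩ ⟨b, hb, hbs⟩
    refine ⟨a + b, I.add_mem ha hb, ?_⟩
    convert add_mem har hbs using 1
    rw [map_add, mul_add]
    abel
  smul_mem' := by
    rintro c r ⟨a, ha, har⟩
    -- A coefficient multiplied from the left is twisted by `β^n` on its way past `t^n`; `d` undoes
    -- the twist.
    obtain ⟨d, rfl⟩ := hs.iterate n c
    refine ⟨i d * a, I.mul_mem_left _ ha, ?_⟩
    convert coeff_mul_mem_lowTerms hβ d har using 1
    rw [mul_sub, ← mul_assoc (i d), mul_pow_twist hβ, smul_eq_mul, map_mul, mul_assoc]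

/-- Coefficients stand to the right of `t`, so left multiplication by `t` raises the degree and
keeps the leading coefficient. -/
theorem leadingIdeal_mono {β : R → R} (hβ : ∀ r, i r * t = t * i (β r))
    (hs : Function.Surjective β) {I J : Ideal A} (hIJ : I ≤ J) {m n : ℕ} (hmn : m ≤ n) :
    leadingIdeal hβ hs I m ≤ leadingIdeal hβ hs J n := by
  rintro r ⟨a, ha, har⟩
  obtain ⟨e, rfl⟩ := Nat.exists_eq_add_of_le hmn
  induction e with
  | zero => exact ⟨a, hIJ ha, har⟩
  | succ e ih =>
    obtain ⟨b, hb, hbr⟩ := ih (Nat.le_add_right _ _)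
    refine ⟨t * b, J.mul_mem_left _ hb, ?_⟩
    have := mul_mem_lowTerms_succ hbr
    rwa [mul_sub, ← mul_assoc, ← pow_succ'] at this

/-- Subtract from an element of `J` an element of `I` with the same leading term and induct on the
degree. -/
theorem le_of_leadingIdeal_le {β : R → R} (hβ : ∀ r, i r * t = t * i (β r))
    (hs : Function.Surjective β) (hgen : ∀ a : A, ∃ n, a ∈ lowTerms i t n) {I J : Ideal A}
    (hIJ : I ≤ J) (h : ∀ n, leadingIdeal hβ hs J n ≤ leadingIdeal hβ hs I n) : J ≤ I := by
  have key : ∀ n, ∀ a ∈ J, a ∈ lowTerms i t n → a ∈ I := by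
    intro n
    induction n with
    | zero => intro a _ ha; rw [lowTerms_zero ha]; exact I.zero_mem
    | succ n ih =>
      intro a haJ ha
      obtain ⟨r, hr⟩ := exists_of_mem_lowTerms_succ ha
      obtain ⟨b, hbI, hb⟩ := h n ⟨a, haJ, hr⟩
      have hab : a - b ∈ lowTerms i t n := by
        convert sub_mem hr hb using 1
        abel
      have := I.add_mem (ih (a - b) (J.sub_mem haJ (hIJ hbI)) hab) hbI
      rwa [sub_add_cancel] at this
  intro a ha
  obtain ⟨n, hn⟩ := hgen a
  exact key n a ha hn

/-- Hilbert's basis theorem for skew polynomials. -/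
theorem isNoetherianRing_of_twist [IsNoetherianRing R] {β : R → R}
    (hβ : ∀ r, i r * t = t * i (β r)) (hs : Function.Surjective β)
    (hgen : ∀ a : A, ∃ n, a ∈ lowTerms i t n) : IsNoetherianRing A := by
  refine monotone_stabilizes_iff_noetherian.1 fun f => ?_
  have hstab : ∀ g : ℕ →o Ideal R, ∃ n, ∀ m, n ≤ m → g n = g m :=
    monotone_stabilizes_iff_noetherian.2 ‹_›
  -- The diagonal chain controls all degrees from `N` on; only the finitely many rows below `N`
  -- remain to be stabilized.
  obtain ⟨N, hN⟩ := hstab ⟨fun n => leadingIdeal hβ hs (f n) n,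
    fun m n hmn => leadingIdeal_mono hβ hs (f.monotone hmn) hmn⟩
  have hrow : ∀ n, ∃ m, ∀ m', m ≤ m' →
      leadingIdeal hβ hs (f m) n = leadingIdeal hβ hs (f m') n := fun n =>
    hstab ⟨fun m => leadingIdeal hβ hs (f m) n,
      fun a b hab => leadingIdeal_mono hβ hs (f.monotone hab) le_rfl⟩
  choose M hM using hrow
  refine ⟨max N ((Finset.range N).sup M), fun m hm => ?_⟩
  have hNm := le_of_max_le_left hm
  refine le_antisymm (f.monotone hm) (le_of_leadingIdeal_le hβ hs hgen (f.monotone hm) fun n => ?_)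
  by_cases hn : n < N
  · have hMn : M n ≤ (Finset.range N).sup M := Finset.le_sup (Finset.mem_range.2 hn)
    rw [← hM n m (hMn.trans (le_of_max_le_right hm)),
      ← hM n _ (hMn.trans (le_max_right _ _))]
  · push Not at hn
    calc leadingIdeal hβ hs (f m) n ≤ leadingIdeal hβ hs (f (max m n)) (max m n) :=
          leadingIdeal_mono hβ hs (f.monotone (le_max_left _ _)) (le_max_right _ _)
      _ = leadingIdeal hβ hs (f N) N := (hN _ (hNm.trans (le_max_left _ _))).symm
      _ ≤ _ := leadingIdeal_mono hβ hs (f.monotone (le_max_left _ _)) hn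

end HilbertBasis

/-! ### Noetherianity, and reduction modulo the uniformizer. -/

namespace SkewPoly

section Noetherian

variable {R : Type u} [CommRing R] {α : R ≃+* R}

instance [IsNoetherianRing R] : IsNoetherianRing (SkewPoly α) := by
  refine isNoetherianRing_of_twist (i := const α) (t := theta α) (β := α.symm)
    (fun r => by rw [theta_mul_const, α.apply_symm_apply]) α.symm.surjective fun a => ?_
  induction a using induction with
  | h0 => exact ⟨0, zero_mem _⟩
  | hm r n =>
    obtain ⟨s, rfl⟩ := α.surjective.iterate n r
    exact ⟨n + 1, AddSubgroup.subset_closure ⟨n, n.lt_succ_self, s, by rw [theta_pow_mul_const]⟩⟩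
  | ha f g hf hg =>
    obtain ⟨a, ha⟩ := hf
    obtain ⟨b, hb⟩ := hg
    exact ⟨max a b, add_mem (lowTerms_mono (le_max_left _ _) ha)
      (lowTerms_mono (le_max_right _ _) hb)⟩

/-- Reversing the multiplication replaces the twist `α⁻¹` by `α`. -/
instance [IsNoetherianRing R] : IsNoetherianRing (SkewPoly α)ᵐᵒᵖ := by
  refine isNoetherianRing_of_twist
    (i := (RingHom.op (const α)).comp (RingEquiv.toOpposite R : R →+* Rᵐᵒᵖ)) (t := op (theta α))
    (β := α) (fun r => ?_) α.surjective fun a => ?_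
  · change op (const α r) * op (theta α) = op (theta α) * op (const α (α r))
    rw [← op_mul, ← op_mul, theta_mul_const]
  · obtain ⟨a, rfl⟩ := op_surjective a
    induction a using induction with
    | h0 => exact ⟨0, zero_mem _⟩
    | hm r n =>
      refine ⟨n + 1, AddSubgroup.subset_closure ⟨n, n.lt_succ_self, r, ?_⟩⟩
      change _ = _ * op (const α r)
      rw [op_mul, op_pow]
    | ha f g hf hg =>
      obtain ⟨a, ha⟩ := hf
      obtain ⟨b, hb⟩ := hg
      exact ⟨max a b, add_mem (lowTerms_mono (le_max_left _ _) ha)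
        (lowTerms_mono (le_max_right _ _) hb)⟩

theorem exists_coeff_eq (α : R ≃+* R) (c : ℕ → R) (n : ℕ) :
    ∃ f : SkewPoly α, ∀ m, coeff f m = if m < n then c m else 0 := by
  induction n with
  | zero => exact ⟨0, by simp⟩
  | succ n ih =>
    obtain ⟨f, hf⟩ := ih
    refine ⟨f + const α (c n) * theta α ^ n, fun m => ?_⟩
    rw [map_add, Pi.add_apply, hf, coeff_const_mul_theta_pow]
    by_cases h : n = m
    · subst h; simp
    · by_cases h' : m < n
      · simp [h, h', h'.trans n.lt_succ_self]
      · simp [h, h', show ¬ m < n + 1 by lia]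

end Noetherian

section Residue

open Polynomial

variable {R : Type u} [CommRing R] [IsLocalRing R] {α : R ≃+* R}

/-- The reduction `R[θ; α] → κ[θ]` modulo the maximal ideal, when `α` induces the identity on the
residue field `κ`. -/
def red (h : ∀ r, IsLocalRing.residue R (α r) = IsLocalRing.residue R r) :
    SkewPoly α →+* (IsLocalRing.ResidueField R)[X] :=
  lift ((C : _ →+* _).comp (IsLocalRing.residue R)) Polynomial.X fun r => by
    rw [RingHom.comp_apply, RingHom.comp_apply, h, X_mul]

variable (h : ∀ r, IsLocalRing.residue R (α r) = IsLocalRing.residue R r)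

theorem coeff_red (f : SkewPoly α) (n : ℕ) :
    (red h f).coeff n = IsLocalRing.residue R (coeff f n) := by
  induction f using induction with
  | h0 => simp
  | ha p q hp hq => simp [hp, hq]
  | hm r i =>
    rw [red, lift_const_mul_theta_pow, RingHom.comp_apply, coeff_const_mul_theta_pow,
      coeff_C_mul_X_pow, apply_ite (IsLocalRing.residue R), map_zero]
    simp only [eq_comm]

theorem red_const (r : R) : red h (const α r) = C (IsLocalRing.residue R r) :=
  lift_const _ _ _ _

theorem red_theta : red h (theta α) = Polynomial.X := lift_theta _ _ _

variable {x : R} (hx : IsLocalRing.maximalIdeal R = Ideal.span {x})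

include hx

theorem residue_eq_zero_iff_dvd (r : R) : IsLocalRing.residue R r = 0 ↔ x ∣ r := by
  rw [IsLocalRing.residue_eq_zero_iff, hx, Ideal.mem_span_singleton]

theorem red_const_uniformizer : red h (const α x) = 0 := by
  rw [red_const, (residue_eq_zero_iff_dvd hx x).2 dvd_rfl, C_0]

theorem exists_eq_const_mul {f : SkewPoly α} (hf : red h f = 0) : ∃ s, f = const α x * s := by
  have hd : ∀ n, x ∣ coeff f n := fun n => by
    rw [← residue_eq_zero_iff_dvd hx, ← coeff_red h, hf, Polynomial.coeff_zero]
  choose c hc using hd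
  obtain ⟨s, hs⟩ := exists_coeff_eq α c (size f)
  refine ⟨s, ext fun n => ?_⟩
  rw [coeff_const_mul, hs]
  split_ifs with hn
  · exact hc n
  · rw [mul_zero, degLT_size f n (not_lt.1 hn)]

include h

theorem dvd_iterate (n : ℕ) : x ∣ α^[n] x ∧ x ∣ α.symm^[n] x := by
  have h1 : ∀ r, x ∣ r → x ∣ α r := fun r hr => by
    rw [← residue_eq_zero_iff_dvd hx, h]
    exact (residue_eq_zero_iff_dvd hx r).2 hr
  have h2 : ∀ r, x ∣ r → x ∣ α.symm r := fun r hr => by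
    rw [← residue_eq_zero_iff_dvd hx, ← h, α.apply_symm_apply]
    exact (residue_eq_zero_iff_dvd hx r).2 hr
  induction n with
  | zero => simp
  | succ n ih =>
    rw [Function.iterate_succ_apply', Function.iterate_succ_apply']
    exact ⟨h1 _ ih.1, h2 _ ih.2⟩

theorem exists_const_mul_eq (s : SkewPoly α) : ∃ s', const α x * s = s' * const α x := by
  induction s using induction with
  | h0 => exact ⟨0, by simp⟩
  | ha p q hp hq =>
    obtain ⟨a, ha⟩ := hp
    obtain ⟨b, hb⟩ := hq
    exact ⟨a + b, by rw [mul_add, ha, hb, add_mul]⟩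
  | hm r n =>
    -- This `c` satisfies `α^n(x c) = x`, so that `θ^n c x = x θ^n`.
    obtain ⟨c, hc⟩ := (dvd_iterate h hx n).2
    refine ⟨const α r * theta α ^ n * const α c, ?_⟩
    have hxn : α^[n] (x * c) = x := by
      rw [← hc]
      exact Function.LeftInverse.iterate (f := α.symm) (g := α) α.apply_symm_apply n x
    rw [mul_assoc _ (const α c), ← map_mul, mul_comm c, mul_assoc, theta_pow_mul_const, hxn,
      ← mul_assoc, ← mul_assoc, ← map_mul, ← map_mul, mul_comm]

theorem exists_eq_mul_const {f : SkewPoly α} (hf : red h f = 0) : ∃ s, f = s * const α x := by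
  obtain ⟨s, rfl⟩ := exists_eq_const_mul h hx hf
  exact exists_const_mul_eq h hx s

/-- If factors `x` could be split off for ever, every power of `x` would divide each coefficient,
against finiteness of multiplicities. -/
theorem exists_eq_mul_const_pow [IsDomain R] [WfDvdMonoid R] {f : SkewPoly α} (hf : f ≠ 0) :
    ∃ n z, f = z * const α x ^ n ∧ red h z ≠ 0 := by
  by_contra! hcon
  have hall : ∀ n, ∃ z, f = z * const α x ^ n := by
    intro n
    induction n with
    | zero => exact ⟨f, by simp⟩
    | succ n ih =>
      obtain ⟨z, hz⟩ := ih
      obtain ⟨s, hs⟩ := exists_eq_mul_const h hx (hcon n z hz)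
      exact ⟨s, by rw [hz, hs, mul_assoc, pow_succ']⟩
  refine hf (ext fun i => ?_)
  have hdvd : ∀ n, x ^ n ∣ coeff f i := fun n => by
    obtain ⟨z, hz⟩ := hall n
    rw [hz, ← map_pow, coeff_mul_const, iterate_map_pow]
    exact (pow_dvd_pow_of_dvd (dvd_iterate h hx i).1 n).mul_left _
  by_contra hne
  have hxu : ¬ IsUnit x := fun hu => by
    have : x ∈ IsLocalRing.maximalIdeal R := hx ▸ Ideal.mem_span_singleton_self x
    exact (IsLocalRing.mem_maximalIdeal x).1 this hu
  obtain ⟨n, hn⟩ := FiniteMultiplicity.of_not_isUnit hxu (by simpa using hne)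
  exact hn (hdvd _)

end Residue

end SkewPoly

/-! ### The inclusion of `S` in `T` and common denominators. -/

section Setting

variable {k : Type v} [Field k] {R : Type u} [CommRing R] [Algebra k R]
  {α : R ≃ₐ[k] R}

theorem inclST_const (r : R) : inclST α (SkewPoly.const (α : R ≃+* R) r) =
    SkewPoly.const (fracAut α) (algebraMap R (FractionRing R) r) := by
  simp [inclST, SkewPoly.map, SkewPoly.lift_const]

theorem inclST_theta :
    inclST α (SkewPoly.theta (α : R ≃+* R)) = SkewPoly.theta (fracAut α) := by
  simp [inclST, SkewPoly.map, SkewPoly.lift_theta]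

theorem inclST_injective : Function.Injective (inclST α) :=
  SkewPoly.map_injective _ _ (IsFractionRing.injective R (FractionRing R))

/-- Each element of `R` is a scalar from `k` plus an element of the maximal ideal; `α` fixes the
former and preserves the latter. -/
theorem residue_aut [IsLocalRing R]
    (hk : Function.Surjective (algebraMap k (IsLocalRing.ResidueField R))) (r : R) :
    IsLocalRing.residue R ((α : R ≃+* R) r) = IsLocalRing.residue R r := by
  obtain ⟨a, ha⟩ := hk (IsLocalRing.residue R r)
  have hker : IsLocalRing.residue R (r - algebraMap k R a) = 0 := by
    rw [map_sub, ← ha, sub_eq_zero]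
    rfl
  have hm : α (r - algebraMap k R a) ∈ IsLocalRing.maximalIdeal R := by
    rw [IsLocalRing.residue_eq_zero_iff, IsLocalRing.mem_maximalIdeal, mem_nonunits_iff] at hker
    rw [IsLocalRing.mem_maximalIdeal, mem_nonunits_iff]
    exact fun hu => hker ((MulEquiv.isUnit_map (α : R ≃+* R)).1 hu)
  rw [map_sub, AlgEquiv.commutes, ← IsLocalRing.residue_eq_zero_iff, map_sub, sub_eq_zero] at hm
  rw [map_sub, sub_eq_zero] at hker
  exact hm.trans hker.symm

theorem exists_mul_eq_inclST [IsDomain R] [IsDiscreteValuationRing R] {x : R}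
    (hx : IsLocalRing.maximalIdeal R = Ideal.span {x})
    (h : ∀ r, IsLocalRing.residue R ((α : R ≃+* R) r) = IsLocalRing.residue R r) (t : RingT α) :
    ∃ n s, t * inclST α (SkewPoly.const (α : R ≃+* R) x) ^ n = inclST α s := by
  induction t using SkewPoly.induction with
  | h0 => exact ⟨0, 0, by simp⟩
  | ha p q hp hq =>
    obtain ⟨a, s, hs⟩ := hp
    obtain ⟨b, s', hs'⟩ := hq
    refine ⟨a + b, s * SkewPoly.const (α : R ≃+* R) x ^ b +
      s' * SkewPoly.const (α : R ≃+* R) x ^ a, ?_⟩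
    rw [map_add, map_mul, map_mul, map_pow, map_pow, ← hs, ← hs', add_mul, mul_assoc, mul_assoc,
      ← pow_add, ← pow_add, add_comm b a]
  | hm q i =>
    obtain ⟨a, b, hb, rfl⟩ := IsFractionRing.div_surjective (A := R) q
    have hb0 : b ≠ 0 := nonZeroDivisors.ne_zero hb
    have hirr : Irreducible x :=
      (IsDiscreteValuationRing.irreducible_iff_uniformizer x).2 hx
    obtain ⟨n, hn⟩ := IsDiscreteValuationRing.associated_pow_irreducible hb0 hirr
    -- Moving `x^n` to the left of `θ^i` turns it into `α^i(x)^n`, which is still a multiple of the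
    -- denominator `b`.
    obtain ⟨c, hc⟩ := hn.dvd.trans (pow_dvd_pow_of_dvd (SkewPoly.dvd_iterate h hx i).1 n)
    refine ⟨n, SkewPoly.const (α : R ≃+* R) (a * c) * SkewPoly.theta (α : R ≃+* R) ^ i, ?_⟩
    have hit : ∀ r : R, (fracAut α)^[i] (algebraMap R (FractionRing R) r) =
        algebraMap R (FractionRing R) ((α : R ≃+* R)^[i] r) := by
      intro r
      refine (Function.Semiconj.iterate_right (f := algebraMap R (FractionRing R))
        (fun r => ?_) i r).symm
      simp [fracAut]
    rw [← map_pow, ← map_pow, inclST_const, mul_assoc, SkewPoly.theta_pow_mul_const, hit,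
      iterate_map_pow, hc, ← mul_assoc, ← map_mul, map_mul (inclST α), inclST_const, map_pow,
      inclST_theta]
    have hbK : algebraMap R (FractionRing R) b ≠ 0 := by simpa using hb0
    congr 2
    rw [map_mul, map_mul]
    field_simp

end Setting

/-! ### The restricted minimum condition. -/

section Chains

/-- Descending chains of left ideals with a common nonzero element become stationary. -/
def ChainsStabilize (B : Type u) [Ring B] : Prop :=
  ∀ t : B, t ≠ 0 → ∀ c : ℕ → Ideal B, Antitone c → (∀ i, t ∈ c i) → ∃ n, ∀ m, n ≤ m → c m = c n

/-- The generators are right factors of `t`, so their degrees are bounded. Past one of maximal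
degree, generators differ by factors of degree zero, which are units. -/
theorem chainsStabilize_of_degree {B : Type u} [Ring B] [IsPrincipalIdealRing B] (δ : B → ℕ)
    (hδ : ∀ a b, a * b ≠ 0 → δ (a * b) = δ a + δ b) (hu : ∀ a, a ≠ 0 → δ a = 0 → IsUnit a) :
    ChainsStabilize B := by
  intro t ht c hc htc
  have hgen : ∀ i, ∃ g, c i = Ideal.span {g} := fun i =>
    (IsPrincipalIdealRing.principal (c i)).principal
  choose g hg using hgen
  have hmem : ∀ {i a}, a ∈ c i ↔ ∃ b, b * g i = a := fun {i a} => by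
    rw [hg i, Ideal.mem_span_singleton']
  have hgi : ∀ i, g i ∈ c i := fun i => hmem.2 ⟨1, one_mul _⟩
  have hg0 : ∀ i, g i ≠ 0 := fun i h0 => by
    obtain ⟨b, hb⟩ := hmem.1 (htc i)
    rw [h0, mul_zero] at hb
    exact ht hb.symm
  have hbound : ∀ i, δ (g i) ≤ δ t := fun i => by
    obtain ⟨b, hb⟩ := hmem.1 (htc i)
    have := hδ b (g i) (by rwa [hb])
    rw [hb] at this
    lia
  obtain ⟨n, hn⟩ : ∃ n, ∀ m, δ (g m) ≤ δ (g n) := by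
    have hfin : (Set.range fun i => δ (g i)).Finite :=
      (Set.finite_le_nat (δ t)).subset (by rintro _ ⟨i, rfl⟩; exact hbound i)
    obtain ⟨_, ⟨n, rfl⟩, hn⟩ := hfin.exists_maximal (Set.range_nonempty _)
    refine ⟨n, fun m => ?_⟩
    by_contra! h
    exact absurd (hn ⟨m, rfl⟩ h.le) (not_le.2 h)
  refine ⟨n, fun m hm => le_antisymm (hc hm) ?_⟩
  obtain ⟨b, hb⟩ := hmem.1 (hc hm (hgi m))
  have h1 := hδ b (g n) (by rw [hb]; exact hg0 m)
  rw [hb] at h1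
  have hb0 : b ≠ 0 := by
    rintro rfl
    exact hg0 m (by rw [← hb, zero_mul])
  have h2 := hn m
  obtain ⟨e, rfl⟩ := hu b hb0 (by lia)
  intro a ha
  obtain ⟨d, rfl⟩ := hmem.1 ha
  have : g n = (↑e⁻¹ : B) * g m := by rw [← hb, Units.inv_mul_cancel_left]
  rw [this, ← mul_assoc]
  exact (c m).mul_mem_left _ (hgi m)

/-- `A` and `B` move each single element to the same places, although the matching scalar depends on
the element. Hence `A`-submodules of `A y` pull back to left ideals of `B` containing `t`. -/
theorem isArtinian_span_singleton {A : Type u} {B : Type v} {M : Type w} [Ring A] [Ring B]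
    [AddCommGroup M] [Module A M] [Module B M] (hB : ChainsStabilize B)
    (hAB : ∀ (a : A) (y : M), ∃ b : B, a • y = b • y)
    (hBA : ∀ (b : B) (y : M), ∃ a : A, b • y = a • y) (y : M) {t : B} (ht : t ≠ 0)
    (hty : t • y = 0) : IsArtinian A (Submodule.span A {y}) := by
  refine monotone_stabilizes_iff_artinian.1 fun f => ?_
  let N : ℕ → Submodule A M := fun i => (OrderDual.ofDual (f i)).map (Submodule.span A {y}).subtype
  let J : ℕ → Ideal B := fun i =>
    { carrier := {b | b • y ∈ N i}
      zero_mem' := by simp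
      add_mem' := fun {a b} ha hb => by
        rw [Set.mem_ofPred_eq, add_smul]
        exact add_mem ha hb
      smul_mem' := fun b a ha => by
        obtain ⟨a', ha'⟩ := hBA b (a • y)
        rw [Set.mem_ofPred_eq, smul_eq_mul, mul_smul, ha']
        exact (N i).smul_mem _ ha }
  have hJ : ∀ {i b}, b ∈ J i ↔ b • y ∈ N i := Iff.rfl
  obtain ⟨n, hn⟩ := hB t ht J (fun i j hij b hb =>
    Submodule.map_mono (f.monotone hij) hb) (fun i => by rw [hJ, hty]; exact zero_mem _)
  refine ⟨n, fun m hm => ?_⟩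
  have hNN : N n ≤ N m := fun v hv => by
    obtain ⟨⟨v, hvy⟩, hvf, rfl⟩ := hv
    obtain ⟨a, rfl⟩ := Submodule.mem_span_singleton.1 hvy
    obtain ⟨b, hb⟩ := hAB a y
    have : b ∈ J m := by
      rw [hn m hm, hJ, ← hb]
      exact ⟨_, hvf, rfl⟩
    rw [hJ, ← hb] at this
    exact this
  have : OrderDual.ofDual (f n) ≤ OrderDual.ofDual (f m) :=
    (Submodule.map_le_map_iff_of_injective (Submodule.subtype_injective _) _ _).1 hNN
  exact le_antisymm (f.monotone hm) this

end Chains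

/-! ### Divisible modules and injectivity. -/

section Divisible

theorem exists_smul_eq_of_injective {A E : Type u} [Ring A] [NoZeroDivisors A]
    [AddCommGroup E] [Module A E] (hE : Module.Injective A E) {a : A} (ha : a ≠ 0) (e : E) :
    ∃ e', a • e' = e := by
  obtain ⟨h, hh⟩ := hE.out (LinearMap.toSpanSingleton A A a) (fun r s hrs => by
    simp only [LinearMap.toSpanSingleton_apply, smul_eq_mul] at hrs
    rw [← sub_eq_zero, ← sub_mul, mul_eq_zero] at hrs
    exact sub_eq_zero.1 (hrs.resolve_right ha)) (LinearMap.toSpanSingleton A E e)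
  refine ⟨h 1, ?_⟩
  have := hh 1
  rw [LinearMap.toSpanSingleton_apply, LinearMap.toSpanSingleton_apply, one_smul, one_smul] at this
  rw [← map_smul, smul_eq_mul, mul_one, this]

variable {A : Type u} {B : Type v} [Ring A] [Ring B] {x : A}

theorem exists_pow_mul_eq (hx : ∀ a, ∃ a', x * a = a' * x) (n : ℕ) (a : A) :
    ∃ a', x ^ n * a = a' * x ^ n := by
  induction n generalizing a with
  | zero => exact ⟨a, by simp⟩
  | succ n ih =>
    obtain ⟨b, hb⟩ := hx a
    obtain ⟨c, hc⟩ := ih b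
    exact ⟨c, by rw [pow_succ, mul_assoc, hb, ← mul_assoc, hc, mul_assoc]⟩

variable {ι : A →+* B}

theorem exists_of_mem_map_ideal (hx : ∀ a, ∃ a', x * a = a' * x)
    (hloc : ∀ b, ∃ n a, ι x ^ n * b = ι a) (I : Ideal A) {j : B} (hj : j ∈ I.map ι) :
    ∃ n, ∃ a ∈ I, ι x ^ n * j = ι a := by
  induction hj using Submodule.span_induction with
  | mem j hj =>
    obtain ⟨a, ha, rfl⟩ := hj
    exact ⟨0, a, ha, by simp⟩
  | zero => exact ⟨0, 0, I.zero_mem, by simp⟩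
  | add j k _ _ hj hk =>
    obtain ⟨m, a, ha, haj⟩ := hj
    obtain ⟨n, b, hb, hbk⟩ := hk
    refine ⟨m + n, x ^ n * a + x ^ m * b, I.add_mem (I.mul_mem_left _ ha) (I.mul_mem_left _ hb), ?_⟩
    rw [map_add, map_mul, map_mul, ← haj, ← hbk, map_pow, map_pow, mul_add, ← mul_assoc,
      ← mul_assoc, ← pow_add, ← pow_add, add_comm n m]
  | smul b j _ hj =>
    obtain ⟨n, a, ha, haj⟩ := hj
    obtain ⟨m, c, hc⟩ := hloc b
    obtain ⟨d, hd⟩ := exists_pow_mul_eq hx n c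
    refine ⟨n + m, d * a, I.mul_mem_left _ ha, ?_⟩
    calc ι x ^ (n + m) * (b * j) = ι x ^ n * (ι x ^ m * b) * j := by
          rw [pow_add]; simp only [mul_assoc]
      _ = ι (x ^ n * c) * j := by rw [hc, map_mul, map_pow]
      _ = ι (d * a) := by rw [hd, map_mul, map_mul, ← haj, map_pow, mul_assoc]

/-- Divisible modules on which `x` acts injectively are injective, if inverting the normal element
`x` gives a principal ideal domain. -/
theorem injective_of_divisible [IsPrincipalIdealRing B] (hι : Function.Injective ι)
    (hx : ∀ a, ∃ a', x * a = a' * x) (hu : IsUnit (ι x)) (hloc : ∀ b, ∃ n a, ι x ^ n * b = ι a)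
    {M : Type w} [AddCommGroup M] [Module A M] (hxM : ∀ y : M, x • y = 0 → y = 0)
    (hdiv : ∀ a : A, a ≠ 0 → ∀ y : M, ∃ y', a • y' = y) : Module.Injective A M := by
  refine Module.Baer.injective fun I f => ?_
  have hxn : ∀ (n : ℕ) (y : M), x ^ n • y = 0 → y = 0 := by
    intro n
    induction n with
    | zero => intro y hy; simpa using hy
    | succ n ih =>
      intro y hy
      rw [pow_succ, mul_smul] at hy
      exact hxM y (ih _ hy)
  obtain ⟨g, hg⟩ := (IsPrincipalIdealRing.principal (I.map ι)).principal
  have hgI : g ∈ I.map ι := by rw [hg]; exact Submodule.mem_span_singleton_self g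
  -- Up to a unit power of `x`, the generator of the extended ideal lies in `I`. As `x` acts
  -- injectively, `f` is determined by its value at this `z`.
  obtain ⟨n, z, hz, hzg⟩ := exists_of_mem_map_ideal hx hloc I hgI
  have hmem : ∀ a ∈ I, ∃ m b, x ^ m * a = b * z := by
    intro a ha
    have haI : ι a ∈ I.map ι := Ideal.mem_map_of_mem ι ha
    rw [hg] at haI
    obtain ⟨b, hb⟩ := Submodule.mem_span_singleton.1 haI
    obtain ⟨v, hv⟩ := hu.pow n
    obtain ⟨m, c, hc⟩ := hloc (b * (↑v⁻¹ : B))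
    refine ⟨m, c, hι ?_⟩
    rw [map_mul, map_mul, ← hzg, ← hc, ← hb, ← hv, smul_eq_mul, map_pow]
    simp only [mul_assoc, Units.inv_mul_cancel_left]
  obtain ⟨y, hy⟩ : ∃ y : M, z • y = f ⟨z, hz⟩ := by
    by_cases hz0 : z = 0
    · refine ⟨0, ?_⟩
      have : (⟨z, hz⟩ : I) = 0 := Subtype.ext hz0
      rw [this, map_zero, smul_zero]
    · exact hdiv z hz0 _
  refine ⟨LinearMap.toSpanSingleton A M y, fun a ha => ?_⟩
  obtain ⟨m, b, hb⟩ := hmem a ha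
  rw [LinearMap.toSpanSingleton_apply, ← sub_eq_zero]
  refine hxn m _ ?_
  rw [smul_sub, sub_eq_zero, ← mul_smul, hb, mul_smul, hy, ← map_smul, ← map_smul]
  congr 1
  exact Subtype.ext hb.symm

theorem injective_of_divisible_of_isPrincipalIdealRing [IsPrincipalIdealRing B]
    {M : Type w} [AddCommGroup M] [Module B M]
    (hdiv : ∀ b : B, b ≠ 0 → ∀ y : M, ∃ y', b • y' = y) : Module.Injective B M :=
  injective_of_divisible (ι := RingHom.id B) (x := 1) Function.injective_id
    (fun a => ⟨a, by simp⟩) (by simp) (fun b => ⟨0, b, by simp⟩) (fun y hy => by simpa using hy)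
    hdiv

end Divisible

/-! ### The Ore condition for elements congruent to 1 modulo a normal element. -/

section Ore

/-- The left ideals `{a | x^n a ∈ Ar + Ac}` ascend, so they stabilize at some `n`. Write `r =
x^(n+1) r' + u c`; stability gives `x^n r' = p r + q c`, and then `(1 - x p) r = (x q + u) c`. -/
theorem exists_mul_eq_mul_of_normal {A : Type u} {P : Type v} [Ring A] [IsNoetherianRing A] [Ring P]
    {π : A →+* P} {x : A} (hx : π x = 0) (hl : ∀ a, π a = 0 → ∃ b, a = x * b)
    (hr : ∀ a, π a = 0 → ∃ b, a = b * x) (r : A) {c : A} (hc : π c = 1) :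
    ∃ c' r', π c' = 1 ∧ c' * r = r' * c := by
  have hsw : ∀ a, ∃ a', x * a = a' * x := fun a => hr _ (by rw [map_mul, hx, zero_mul])
  -- Since `c` is 1 modulo `x`, the term `b (1 - c)` of `b = b (1 - c) + b c` yields one more factor
  -- `x`.
  have hdec : ∀ (n : ℕ) (a : A), ∃ a' q, a = x ^ n * a' + q * c := by
    intro n
    induction n with
    | zero => exact fun a => ⟨a, 0, by simp⟩
    | succ n ih =>
      intro a
      obtain ⟨b, q, hb⟩ := ih a
      obtain ⟨d, hd⟩ := hl (b * (1 - c)) (by rw [map_mul, map_sub, hc, map_one, sub_self, mul_zero])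
      refine ⟨d, x ^ n * b + q, ?_⟩
      rw [pow_succ, mul_assoc, ← hd, hb]
      noncomm_ring
  let J : Ideal A := Ideal.span {r, c}
  have hJ : ∀ {a}, a ∈ J ↔ ∃ p q, p * r + q * c = a := fun {a} => Submodule.mem_span_pair
  let L : ℕ → Ideal A := fun n =>
    { carrier := {a | x ^ n * a ∈ J}
      zero_mem' := by simp
      add_mem' := fun {a b} ha hb => by
        rw [Set.mem_ofPred_eq, mul_add]
        exact J.add_mem ha hb
      smul_mem' := fun b a ha => by
        obtain ⟨b', hb'⟩ := exists_pow_mul_eq hsw n b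
        rw [Set.mem_ofPred_eq, smul_eq_mul, ← mul_assoc, hb', mul_assoc]
        exact J.mul_mem_left _ ha }
  have hL : Monotone L := monotone_nat_of_le_succ fun n a ha => by
    change x ^ (n + 1) * a ∈ J
    rw [pow_succ', mul_assoc]
    exact J.mul_mem_left _ ha
  obtain ⟨n, hn⟩ := (monotone_stabilizes_iff_noetherian (R := A) (M := A)).2 inferInstance ⟨L, hL⟩
  obtain ⟨r', u, hru⟩ := hdec (n + 1) r
  have h1 : r' ∈ L (n + 1) := hJ.2 ⟨1, -u, by
    rw [one_mul, neg_mul, ← sub_eq_add_neg, sub_eq_iff_eq_add]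
    exact hru⟩
  have h2 : r' ∈ L n := by
    have : L n = L (n + 1) := hn (n + 1) n.le_succ
    rwa [this]
  obtain ⟨p, q, hpq⟩ := hJ.1 h2
  refine ⟨1 - x * p, x * q + u, by rw [map_sub, map_mul, hx, zero_mul, map_one, sub_zero], ?_⟩
  have : r = x * (p * r + q * c) + u * c := by
    rw [hpq, ← mul_assoc, ← pow_succ']
    exact hru
  calc (1 - x * p) * r = r - x * (p * r) := by noncomm_ring
    _ = (x * (p * r + q * c) + u * c) - x * (p * r) := by rw [← this]
    _ = _ := by noncomm_ring

end Ore

/-- `ι : A → B` inverts the powers of the element `x`, which generates the kernel of `π` both as a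
left and as a right ideal. -/
structure IsNormalLocalization {A : Type u} {B : Type v} {P : Type w} [Ring A] [Ring B] [Ring P]
    (ι : A →+* B) (π : A →+* P) (x : A) : Prop where
  injective : Function.Injective ι
  map_eq_zero : π x = 0
  exists_eq_mul : ∀ a, π a = 0 → ∃ b, a = x * b
  exists_eq_mul' : ∀ a, π a = 0 → ∃ b, a = b * x
  isUnit : IsUnit (ι x)
  exists_pow_mul : ∀ b, ∃ n a, ι x ^ n * b = ι a
  exists_eq_pow_mul : ∀ a, a ≠ 0 → ∃ n z, a = x ^ n * z ∧ π z ≠ 0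

/-! ### Localization at a normal element: torsion, annihilators, extension of the action. -/

namespace IsNormalLocalization

variable {A : Type u} {B : Type v} {P : Type w} [Ring A] [Ring B] [Ring P]
  {ι : A →+* B} {π : A →+* P} {x : A}

section Basic

theorem mul_comm_left (H : IsNormalLocalization ι π x) (a : A) : ∃ a', x * a = a' * x :=
  H.exists_eq_mul' _ (by rw [map_mul, H.map_eq_zero, zero_mul])

theorem mul_comm_right (H : IsNormalLocalization ι π x) (a : A) : ∃ a', a * x = x * a' :=
  H.exists_eq_mul _ (by rw [map_mul, H.map_eq_zero, mul_zero])

theorem ne_zero [Nontrivial B] (H : IsNormalLocalization ι π x) : x ≠ 0 := by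
  rintro rfl
  exact not_isUnit_zero (map_zero ι ▸ H.isUnit)

/-- This gives `Bz ∩ A = Az` when `π z ≠ 0`: in `x^n a = c z` with `n > 0` the domain `P` forces `π
c = 0`, so a factor `x` cancels. -/
theorem exists_eq_map_of_mul_eq [IsDomain A] [NoZeroDivisors P] [Nontrivial B]
    (H : IsNormalLocalization ι π x) {a z : A} {b : B} (h : ι a = b * ι z) (hz : π z ≠ 0) :
    ∃ b', b = ι b' := by
  obtain ⟨n, c, hc⟩ := H.exists_pow_mul b
  have hac : x ^ n * a = c * z := H.injective (by
    rw [map_mul, map_mul, ← hc, h, map_pow, mul_assoc])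
  induction n generalizing c with
  | zero => exact ⟨c, by simpa using hc⟩
  | succ n ih =>
    have hc0 : π c = 0 := by
      have := congrArg π hac
      rw [map_mul, map_mul, map_pow, H.map_eq_zero, zero_pow n.succ_ne_zero, zero_mul] at this
      exact (mul_eq_zero.1 this.symm).resolve_right hz
    obtain ⟨d, rfl⟩ := H.exists_eq_mul c hc0
    rw [pow_succ', mul_assoc, mul_assoc] at hac
    refine ih d ?_ (mul_left_cancel₀ H.ne_zero hac)
    rw [pow_succ', mul_assoc, map_mul] at hc
    exact H.isUnit.mul_left_cancel hc

end Basic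

section Modules

variable {M : Type*} [AddCommGroup M] [Module B M]

theorem eq_zero_of_smul_eq_zero (H : IsNormalLocalization ι π x) {m : M} (h : ι x • m = 0) :
    m = 0 :=
  H.isUnit.smul_eq_zero.1 h

theorem eq_zero_of_pow_smul_eq_zero (H : IsNormalLocalization ι π x) {n : ℕ} {m : M}
    (h : ι x ^ n • m = 0) : m = 0 :=
  (H.isUnit.pow n).smul_eq_zero.1 h

/-- If `1 - a x` kills `m`, then `m = a (x m)`, so dividing by `x` can be done with an element of
`A`. -/
theorem exists_smul_eq_of_torsion (H : IsNormalLocalization ι π x)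
    (hM : ∀ m : M, ∃ c, π c = 1 ∧ ι c • m = 0) (b : B) (m : M) : ∃ a, b • m = ι a • m := by
  have hdiv : ∀ m : M, ∃ a, m = ι (a * x) • m := fun m => by
    obtain ⟨c, hc, hcm⟩ := hM m
    obtain ⟨a, ha⟩ := H.exists_eq_mul' (1 - c) (by rw [map_sub, hc, map_one, sub_self])
    exact ⟨a, by rw [← ha, map_sub, sub_smul, hcm, sub_zero, map_one, one_smul]⟩
  have key : ∀ (n : ℕ) (m m' : M), ι x ^ n • m' = m → ∃ a, m' = ι a • m := by
    intro n
    induction n with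
    | zero => intro m m' h; exact ⟨1, by simpa using h⟩
    | succ n ih =>
      intro m m' h
      rw [pow_succ, mul_smul] at h
      obtain ⟨a, ha⟩ := ih m _ h
      obtain ⟨d, hd⟩ := hdiv m'
      exact ⟨d * a, by rw [map_mul, mul_smul, ← ha, ← mul_smul, ← map_mul]; exact hd⟩
  obtain ⟨n, a, ha⟩ := H.exists_pow_mul b
  obtain ⟨d, hd⟩ := key n (ι a • m) (b • m) (by rw [← mul_smul, ha])
  exact ⟨d * a, by rw [hd, map_mul, mul_smul]⟩

/-- The elements of a module that are killed by an element of `1 + xA` form a submodule. -/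
def torsionSubmodule (H : IsNormalLocalization ι π x)
    (hore : ∀ r c, π c = 1 → ∃ c' r', π c' = 1 ∧ c' * r = r' * c)
    (M : Type*) [AddCommGroup M] [Module B M] : Submodule B M where
  carrier := {m | ∃ c, π c = 1 ∧ ι c • m = 0}
  zero_mem' := ⟨1, map_one π, smul_zero _⟩
  add_mem' := by
    rintro m m' ⟨c, hc, hcm⟩ ⟨d, hd, hdm⟩
    obtain ⟨c', r', hc', h⟩ := hore c d hd
    refine ⟨c' * c, by rw [map_mul, hc', hc, one_mul], ?_⟩
    rw [smul_add, map_mul, mul_smul, hcm, smul_zero, ← map_mul, h, map_mul, mul_smul, hdm,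
      smul_zero, add_zero]
  smul_mem' := by
    rintro b m ⟨c, hc, hcm⟩
    obtain ⟨n, a, ha⟩ := H.exists_pow_mul b
    obtain ⟨d, r', hd, h⟩ := hore a c hc
    -- Since `(1 + x e) x = x (1 + e x)`, elements of `1 + xA` pass the denominator `x^n` without
    -- leaving `1 + xA`.
    have hswap : ∀ (n : ℕ) (d : A), π d = 1 → ∃ d', π d' = 1 ∧ d * x ^ n = x ^ n * d' := by
      intro n
      induction n with
      | zero => intro d hd; exact ⟨d, hd, by simp⟩
      | succ n ih =>
        intro d hd
        obtain ⟨e, he⟩ := H.exists_eq_mul (d - 1) (by rw [map_sub, hd, map_one, sub_self])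
        obtain ⟨f, hf, hef⟩ := ih (1 + e * x)
          (by rw [map_add, map_mul, H.map_eq_zero, map_one, mul_zero, add_zero])
        refine ⟨f, hf, ?_⟩
        rw [pow_succ', mul_assoc, ← hef, ← sub_add_cancel d 1, he]
        noncomm_ring
    obtain ⟨d', hd', hdd⟩ := hswap n d hd
    refine ⟨d', hd', H.eq_zero_of_pow_smul_eq_zero (n := n) ?_⟩
    rw [← mul_smul, ← map_pow, ← map_mul, ← hdd, map_mul, map_pow, ← mul_smul, mul_assoc, ha,
      ← map_mul, h, map_mul, mul_smul, hcm, smul_zero]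

/-- The annihilator of a generator of a simple torsion `B`-module. -/
theorem exists_irreducible_annihilator [IsDomain A] [IsDomain B] [IsPrincipalIdealRing B]
    [NoZeroDivisors P] [Nontrivial P] (H : IsNormalLocalization ι π x) {m : M} (hm : m ≠ 0)
    (hs : ∀ b : B, b • m ≠ 0 → ∃ b' : B, b' • b • m = m) {t : B} (ht : t ≠ 0) (htm : t • m = 0) :
    ∃ z, π z ≠ 0 ∧ Irreducible z ∧ ∀ a, ι a • m = 0 ↔ ∃ b, a = b * z := by
  obtain ⟨g, hg⟩ := (IsPrincipalIdealRing.principal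
    (LinearMap.ker (LinearMap.toSpanSingleton B M m))).principal
  have hmem : ∀ b : B, b • m = 0 ↔ ∃ d, b = d * g := fun b => by
    rw [← LinearMap.toSpanSingleton_apply B M m b, ← LinearMap.mem_ker, hg,
      Submodule.mem_span_singleton]
    simp only [smul_eq_mul, eq_comm]
  have hg0 : g ≠ 0 := by
    rintro rfl
    obtain ⟨d, hd⟩ := (hmem t).1 htm
    exact ht (by rw [hd, mul_zero])
  have hgm : g • m = 0 := (hmem g).2 ⟨1, (one_mul g).symm⟩
  obtain ⟨n, a, ha⟩ := H.exists_pow_mul g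
  have ha0 : a ≠ 0 := by
    rintro rfl
    rw [map_zero] at ha
    exact (mul_ne_zero (H.isUnit.pow n).ne_zero hg0) ha
  -- Clearing denominators and then splitting off powers of `x` changes the generator `g` only by
  -- units of `B`.
  obtain ⟨k, z, rfl, hz⟩ := H.exists_eq_pow_mul a ha0
  have hzm : ι z • m = 0 := H.eq_zero_of_pow_smul_eq_zero (n := k) (by
    rw [← mul_smul, ← map_pow, ← map_mul, ← ha, mul_smul, hgm, smul_zero])
  obtain ⟨v, hv⟩ := H.isUnit.pow n
  have hgz : g = (↑v⁻¹ * ι x ^ k) * ι z := by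
    rw [map_mul, ← hv, map_pow] at ha
    rw [mul_assoc, ← ha, Units.inv_mul_cancel_left]
  have hB : ∀ b : B, b • m = 0 → ∃ d, b = d * ι z := fun b hb => by
    obtain ⟨d, rfl⟩ := (hmem b).1 hb
    exact ⟨d * (↑v⁻¹ * ι x ^ k), by rw [mul_assoc, ← hgz]⟩
  have hA : ∀ a, ι a • m = 0 → ∃ b, a = b * z := fun a ha => by
    obtain ⟨d, hd⟩ := hB _ ha
    obtain ⟨b, rfl⟩ := H.exists_eq_map_of_mul_eq hd hz
    exact ⟨b, H.injective (by rw [hd, map_mul])⟩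
  have hz0 : z ≠ 0 := by
    rintro rfl
    exact hz (map_zero π)
  refine ⟨z, hz, ⟨fun hu => hm ?_, fun a b hab => ?_⟩, fun a => ⟨hA a, ?_⟩⟩
  · exact (hu.map ι).smul_eq_zero.1 hzm
  -- If `b` kills `m`, then `b ∈ Az` and `a` is invertible. Otherwise `b m` generates, so `1 ∈ Bb`;
  -- as `π b ≠ 0`, already `1 ∈ Ab`.
  · by_cases hbm : ι b • m = 0
    · obtain ⟨d, hd⟩ := hA b hbm
      left
      have : d * a = 1 := by
        have h1 : b ≠ 0 := by
          rintro rfl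
          exact hz0 (by rw [hab, mul_zero])
        refine mul_right_cancel₀ h1 ?_
        rw [mul_assoc, ← hab, ← hd, one_mul]
      exact ⟨⟨a, d, mul_eq_one_symm this, this⟩, rfl⟩
    · right
      obtain ⟨d, hd⟩ := hs _ hbm
      obtain ⟨e, he⟩ := hB (1 - d * ι b) (by rw [sub_smul, one_smul, mul_smul, hd, sub_self])
      have hb1 : ι 1 = (d + e * ι a) * ι b := by
        rw [map_one, add_mul, mul_assoc, ← map_mul, ← hab, ← he, add_sub_cancel]
      have hπb : π b ≠ 0 := fun h0 => hz (by rw [hab, map_mul, h0, mul_zero])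
      obtain ⟨f, hf⟩ := H.exists_eq_map_of_mul_eq hb1 hπb
      have hfb : f * b = 1 := H.injective (by rw [map_mul, ← hf, ← hb1])
      exact ⟨⟨b, f, mul_eq_one_symm hfb, hfb⟩, rfl⟩
  · rintro ⟨b, rfl⟩
    rw [map_mul, mul_smul, hzm, smul_zero]

end Modules

section Extension

variable {V : Type*} [AddCommGroup V] [Module A V]

/-- `w = b v`, expressed by the action of `A`. -/
def IsSMul (ι : A →+* B) (x : A) (b : B) (v w : V) : Prop :=
  ∃ n a, ι x ^ n * b = ι a ∧ x ^ n • w = a • v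

theorem pow_smul_injective (hV : Function.Bijective fun v : V => x • v) (n : ℕ) :
    Function.Bijective fun v : V => x ^ n • v := by
  induction n with
  | zero =>
    have : (fun v : V => x ^ 0 • v) = id := funext fun v => by simp
    exact this ▸ Function.bijective_id
  | succ n ih =>
    have : (fun v : V => x ^ (n + 1) • v) = (fun v : V => x ^ n • v) ∘ fun v => x • v := by
      funext v
      simp [pow_succ, mul_smul]
    rw [this]
    exact ih.comp hV

theorem IsSMul.unique (H : IsNormalLocalization ι π x)
    (hV : Function.Bijective fun v : V => x • v) {b : B} {v w w' : V}
    (h : IsSMul ι x b v w) (h' : IsSMul ι x b v w') : w = w' := by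
  obtain ⟨n, a, ha, hw⟩ := h
  obtain ⟨n', a', ha', hw'⟩ := h'
  have haa : x ^ n' * a = x ^ n * a' := H.injective (by
    rw [map_mul, map_mul, ← ha, ← ha', map_pow, map_pow, ← mul_assoc, ← mul_assoc, ← pow_add,
      ← pow_add, add_comm])
  refine (pow_smul_injective hV (n' + n)).1 ?_
  change x ^ (n' + n) • w = x ^ (n' + n) • w'
  rw [pow_add, mul_smul, hw, ← mul_smul, haa, mul_smul, ← hw', ← mul_smul, ← pow_add, ← pow_add,
    add_comm]

theorem exists_isSMul (H : IsNormalLocalization ι π x)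
    (hV : Function.Bijective fun v : V => x • v) (b : B) (v : V) : ∃ w, IsSMul ι x b v w := by
  obtain ⟨n, a, ha⟩ := H.exists_pow_mul b
  obtain ⟨w, hw⟩ := (pow_smul_injective hV n).2 (a • v)
  exact ⟨w, n, a, ha, hw⟩

theorem IsSMul.map {a : A} {v : V} : IsSMul ι x (ι a) v (a • v) := ⟨0, a, by simp, by simp⟩

theorem IsSMul.add_right {b : B} {v v' w w' : V} (H : IsNormalLocalization ι π x)
    (hw : IsSMul ι x b v w) (hw' : IsSMul ι x b v' w') : IsSMul ι x b (v + v') (w + w') := by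
  obtain ⟨n, a, ha, hw⟩ := hw
  obtain ⟨n', a', ha', hw'⟩ := hw'
  have haa : x ^ n' * a = x ^ n * a' := H.injective (by
    rw [map_mul, map_mul, ← ha, ← ha', map_pow, map_pow, ← mul_assoc, ← mul_assoc, ← pow_add,
      ← pow_add, add_comm])
  refine ⟨n' + n, x ^ n' * a, by rw [map_mul, ← ha, ← mul_assoc, pow_add, map_pow], ?_⟩
  have h1 : x ^ (n' + n) • w = (x ^ n' * a) • v := by rw [pow_add, mul_smul, hw, mul_smul]
  have h2 : x ^ (n' + n) • w' = (x ^ n' * a) • v' := by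
    rw [haa, add_comm, pow_add, mul_smul, hw', mul_smul]
  rw [smul_add, smul_add, h1, h2]

theorem IsSMul.add_left {b b' : B} {v w w' : V}
    (hw : IsSMul ι x b v w) (hw' : IsSMul ι x b' v w') : IsSMul ι x (b + b') v (w + w') := by
  obtain ⟨n, a, ha, hw⟩ := hw
  obtain ⟨n', a', ha', hw'⟩ := hw'
  refine ⟨n + n', x ^ n' * a + x ^ n * a', ?_, ?_⟩
  · rw [map_add, map_mul, map_mul, ← ha, ← ha', map_pow, map_pow, mul_add, ← mul_assoc,
      ← mul_assoc, ← pow_add, ← pow_add, add_comm n' n]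
  · rw [add_smul, smul_add, mul_smul, mul_smul, ← hw, ← hw', ← mul_smul, ← mul_smul, ← pow_add,
      ← pow_add, add_comm n' n]

theorem IsSMul.mul {b b' : B} {v w w' : V} (H : IsNormalLocalization ι π x)
    (hw : IsSMul ι x b' v w) (hw' : IsSMul ι x b w w') : IsSMul ι x (b * b') v w' := by
  obtain ⟨n, a, ha, hw⟩ := hw
  obtain ⟨n', a', ha', hw'⟩ := hw'
  obtain ⟨d, hd⟩ := exists_pow_mul_eq H.mul_comm_left n a'
  refine ⟨n + n', d * a, ?_, ?_⟩
  · calc ι x ^ (n + n') * (b * b') = ι x ^ n * (ι x ^ n' * b) * b' := by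
          rw [pow_add]; simp only [mul_assoc]
      _ = ι (x ^ n * a') * b' := by rw [ha', map_mul, map_pow]
      _ = ι (d * a) := by rw [hd, map_mul, map_mul, ← ha, map_pow, mul_assoc]
  · rw [pow_add, mul_smul, hw', ← mul_smul, hd, mul_smul, hw, mul_smul]

/-- A module on which `x` acts bijectively is a module over the localization. -/
theorem exists_module (H : IsNormalLocalization ι π x)
    (hV : Function.Bijective fun v : V => x • v) :
    ∃ _ : Module B V, ∀ (a : A) (v : V), ι a • v = a • v := by
  choose f hf using fun (b : B) (v : V) => H.exists_isSMul hV b v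
  have huniq : ∀ {b v w}, IsSMul ι x b v w → f b v = w := fun h => (hf _ _).unique H hV h
  have hone : ∀ v, f 1 v = v := fun v =>
    huniq (by simpa using IsSMul.map (ι := ι) (x := x) (a := 1) (v := v))
  have hadd : ∀ b b' v, f (b + b') v = f b v + f b' v := fun b b' v =>
    huniq ((hf b v).add_left (hf b' v))
  have hadd' : ∀ b v v', f b (v + v') = f b v + f b v' := fun b v v' =>
    huniq ((hf b v).add_right H (hf b v'))
  refine ⟨{
    smul := f
    one_smul := hone
    mul_smul := fun b b' v => huniq ((hf b' v).mul H (hf b _))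
    smul_zero := fun b => ?_
    smul_add := hadd'
    add_smul := hadd
    zero_smul := fun v => ?_ }, fun a v => huniq IsSMul.map⟩
  · have := hadd' b 0 0
    rw [add_zero] at this
    exact left_eq_add.1 this
  · have := hadd 0 0 v
    rw [add_zero] at this
    exact left_eq_add.1 this

end Extension

end IsNormalLocalization

/-! ### Direct sums of injective hulls of simple modules. -/

section Decomposition

variable {B : Type u} [Ring B] {F : Type u} [AddCommGroup F] [Module B F]

theorem exists_maximal_disjoint {D U : Submodule B F} (h : Disjoint D U) :
    ∃ K, D ≤ K ∧ Disjoint K U ∧ ∀ K', K ≤ K' → Disjoint K' U → K' = K := by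
  obtain ⟨K, hDK, hK⟩ := zorn_le_nonempty₀ {K : Submodule B F | Disjoint K U} (fun c hc hcc y _ =>
    ⟨sSup c, (hcc.directedOn.disjoint_sSup_left).2 fun K hK => hc hK, fun K hK => le_sSup hK⟩) D h
  exact ⟨K, hDK, hK.prop, fun K' hKK' hK' => (hK.le_of_ge hK' hKK').antisymm hKK'⟩

variable (B) in
/-- A submodule all of whose elements are divisible in it. -/
def IsDivisibleSubmodule (N : Submodule B F) : Prop :=
  ∀ b : B, b ≠ 0 → ∀ y ∈ N, ∃ y' ∈ N, b • y' = y

/-- `N` is an essential extension of a simple submodule. -/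
def HasSimpleEssential (N : Submodule B F) : Prop :=
  ∃ U ≤ N, IsAtom U ∧ ∀ L ≤ N, Disjoint L U → L = ⊥

theorem IsDivisibleSubmodule.injective [IsPrincipalIdealRing B] {N : Submodule B F}
    (hN : IsDivisibleSubmodule B N) : Module.Injective B N :=
  injective_of_divisible_of_isPrincipalIdealRing fun b hb y => by
    obtain ⟨y', hy', h⟩ := hN b hb y y.2
    exact ⟨⟨y', hy'⟩, Subtype.ext h⟩

theorem IsDivisibleSubmodule.sSup {𝒮 : Set (Submodule B F)}
    (h : ∀ N ∈ 𝒮, IsDivisibleSubmodule B N) : IsDivisibleSubmodule B (sSup 𝒮) := by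
  intro b hb y hy
  rw [sSup_eq_iSup'] at hy
  rw [sSup_eq_iSup']
  induction hy using Submodule.iSup_induction' with
  | mem N y hy =>
    obtain ⟨y', hy', h⟩ := h N N.2 b hb y hy
    exact ⟨y', Submodule.mem_iSup_of_mem N hy', h⟩
  | zero => exact ⟨0, zero_mem _, smul_zero b⟩
  | add y z _ _ hy hz =>
    obtain ⟨y', hy', rfl⟩ := hy
    obtain ⟨z', hz', rfl⟩ := hz
    exact ⟨y' + z', add_mem hy' hz', smul_add b _ _⟩

/-- In an injective module, a simple submodule which is disjoint from `D` has an injective hull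
which is disjoint from `D`. -/
theorem exists_hull_disjoint (hF : Module.Injective B F)
    (hdiv : ∀ b : B, b ≠ 0 → ∀ y : F, ∃ y', b • y' = y) {D U : Submodule B F} (hU : IsAtom U)
    (hDU : Disjoint D U) :
    ∃ N, Disjoint D N ∧ N ≠ ⊥ ∧ IsDivisibleSubmodule B N ∧ HasSimpleEssential N := by
  obtain ⟨K, hDK, hKU, hK⟩ := exists_maximal_disjoint hDU
  obtain ⟨N, hUN, hNK, hN⟩ := exists_maximal_disjoint hKU.symm
  obtain ⟨ψ, hψ⟩ := hF.out (N.subtype.coprod K.subtype) (by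
    rw [← LinearMap.ker_eq_bot, LinearMap.ker_coprod_of_disjoint_range]
    · simp
    · simpa using hNK) (N.subtype.coprod (0 : K →ₗ[B] F))
  have hψN : ∀ n ∈ N, ψ n = n := fun n hn => by simpa using hψ (⟨n, hn⟩, 0)
  have hψK : ∀ n ∈ K, ψ n = 0 := fun n hn => by simpa using hψ (0, ⟨n, hn⟩)
  -- `ψ` extends the projection of `N ⊕ K` to `N`. Maximality of `K` makes the preimage of `range ψ
  -- ∩ K` equal to `K`, so this intersection is zero, and maximality of `N` applies. Thus `N` is a
  -- retract of `F` and inherits divisibility.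
  have hrange : LinearMap.range ψ = N := by
    refine hN _ (fun n hn => ⟨n, hψN n hn⟩) ?_
    have hL : (LinearMap.range ψ ⊓ K).comap ψ = K := by
      refine hK _ (fun y hy => ?_) ?_
      · rw [Submodule.mem_comap, hψK y hy]
        exact zero_mem _
      · rw [Submodule.disjoint_def]
        intro y hy hyU
        rw [Submodule.mem_comap, hψN y (hUN hyU)] at hy
        exact (Submodule.disjoint_def.1 hKU) y hy.2 hyU
    rw [Submodule.disjoint_def]
    rintro _ ⟨y, rfl⟩ hy
    have : y ∈ (LinearMap.range ψ ⊓ K).comap ψ := ⟨⟨y, rfl⟩, hy⟩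
    rw [hL] at this
    exact hψK y this
  refine ⟨N, (hNK.mono_right hDK).symm, ne_bot_of_le_ne_bot hU.1 hUN, fun b hb y hy => ?_,
    U, hUN, hU, fun L hLN hLU => ?_⟩
  · obtain ⟨y', rfl⟩ := hdiv b hb y
    exact ⟨ψ y', hrange ▸ ⟨y', rfl⟩, by rw [← map_smul, hψN _ hy]⟩
  -- Essentiality: `L + K` still avoids `U`, so maximality of `K` puts `L` inside `N ∩ K = 0`.
  · have hLK : L ⊔ K = K := by
      refine hK _ le_sup_right ?_
      rw [Submodule.disjoint_def]
      intro y hy hyU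
      obtain ⟨l, hl, m, hm, rfl⟩ := Submodule.mem_sup.1 hy
      have hmN : m ∈ N := by
        have := N.sub_mem (hUN hyU) (hLN hl)
        rwa [add_sub_cancel_left] at this
      have hm0 : m = 0 := Submodule.disjoint_def.1 hNK m hmN hm
      rw [hm0, add_zero] at hyU ⊢
      exact Submodule.disjoint_def.1 hLU l hl hyU
    exact le_bot_iff.1 (hNK hLN (sup_eq_right.1 hLK))

theorem sSupIndep_insert {α : Type*} [CompleteLattice α] [IsModularLattice α] {s : Set α} {a : α}
    (hs : sSupIndep s) (ha : Disjoint (sSup s) a) : sSupIndep (insert a s) := by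
  intro y hy
  by_cases hya : y = a
  · rw [hya]
    exact (ha.mono_left (sSup_le_sSup fun z hz =>
      hz.1.resolve_left hz.2)).symm
  · have hys : y ∈ s := hy.resolve_left hya
    have h : insert a s \ {y} = insert a (s \ {y}) := Set.insert_sdiff_of_notMem _ (by
      rw [Set.mem_singleton_iff]; exact Ne.symm hya)
    rw [h, sSup_insert, sup_comm]
    refine (hs hys).disjoint_sup_right_of_disjoint_sup_left (ha.mono_left ?_)
    exact sup_le (le_sSup hys) (sSup_le_sSup Set.sdiff_subset)

/-- Over a principal ideal domain, a divisible module in which every nonzero submodule contains a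
simple one is a direct sum of injective hulls of simple modules. -/
theorem exists_decomposition [IsPrincipalIdealRing B]
    (hdiv : ∀ b : B, b ≠ 0 → ∀ y : F, ∃ y', b • y' = y)
    (hsoc : ∀ K : Submodule B F, K ≠ ⊥ → ∃ U ≤ K, IsAtom U) :
    ∃ 𝒮 : Set (Submodule B F), sSupIndep 𝒮 ∧ sSup 𝒮 = ⊤ ∧
      ∀ N ∈ 𝒮, IsDivisibleSubmodule B N ∧ HasSimpleEssential N := by
  have zorn := zorn_subset
    (S := {𝒮 : Set (Submodule B F) | sSupIndep 𝒮 ∧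
      ∀ N ∈ 𝒮, IsDivisibleSubmodule B N ∧ HasSimpleEssential N})
    fun c hc1 hc2 =>
      ⟨⋃₀ c, ⟨iSupIndep_sUnion_of_directed hc2.directedOn fun s hs => (hc1 hs).1,
        fun N ⟨s, sc, hN⟩ => (hc1 sc).2 N hN⟩, fun _ => Set.subset_sUnion_of_mem⟩
  obtain ⟨𝒮, h𝒮⟩ := zorn
  obtain ⟨hind, hhull⟩ := h𝒮.prop
  refine ⟨𝒮, hind, ?_, hhull⟩
  by_contra htop
  -- A sum of divisible submodules is divisible, hence injective and a direct summand. A simple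
  -- submodule of the complement would have a hull enlarging the maximal family.
  have hD : IsDivisibleSubmodule B (sSup 𝒮) := IsDivisibleSubmodule.sSup fun N hN => (hhull N hN).1
  obtain ⟨ρ, hρ⟩ := hD.injective.out (sSup 𝒮).subtype (Submodule.subtype_injective _) LinearMap.id
  have hker : LinearMap.ker ρ ≠ ⊥ := by
    intro hbot
    refine htop (eq_top_iff.2 fun y _ => ?_)
    have hy : y - (ρ y : F) ∈ LinearMap.ker ρ := by
      rw [LinearMap.mem_ker, map_sub, sub_eq_zero]
      exact (hρ (ρ y)).symm
    rw [hbot, Submodule.mem_bot, sub_eq_zero] at hy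
    rw [hy]
    exact (ρ y).2
  obtain ⟨U, hUk, hU⟩ := hsoc _ hker
  have hDU : Disjoint (sSup 𝒮) U := by
    rw [Submodule.disjoint_def]
    intro y hy hyU
    have h1 := hρ ⟨y, hy⟩
    have h2 : ρ y = 0 := hUk hyU
    exact congrArg Subtype.val (h1.symm.trans h2)
  obtain ⟨N, hDN, hN0, hN⟩ :=
    exists_hull_disjoint (injective_of_divisible_of_isPrincipalIdealRing hdiv) hdiv hU hDU
  have hmem : N ∈ 𝒮 := h𝒮.le_of_ge (y := insert N 𝒮) ⟨sSupIndep_insert hind hDN, by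
    rintro L (rfl | hL)
    · exact hN
    · exact hhull L hL⟩ (Set.subset_insert N 𝒮) (Set.mem_insert N 𝒮)
  exact hN0 (disjoint_self.1 (hDN.mono_left (le_sSup hmem)))

theorem exists_isAtom_le [IsPrincipalIdealRing B] (hB : ChainsStabilize B)
    (htor : ∀ y : F, ∃ b : B, b ≠ 0 ∧ b • y = 0) (K : Submodule B F) (hK : K ≠ ⊥) :
    ∃ U ≤ K, IsAtom U := by
  obtain ⟨y, hyK, hy⟩ := Submodule.exists_mem_ne_zero_of_ne_bot hK
  obtain ⟨b, hb, hby⟩ := htor y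
  have hart : IsArtinian B (Submodule.span B {y}) :=
    isArtinian_span_singleton hB (fun a _ => ⟨a, rfl⟩) (fun a _ => ⟨a, rfl⟩) y hb hby
  obtain ⟨L, hL, hmin⟩ := IsArtinian.set_has_minimal
    {L : Submodule B (Submodule.span B {y}) | L ≠ ⊥}
    ⟨⊤, fun h => hy (by
      have : (⟨y, Submodule.mem_span_singleton_self y⟩ : Submodule.span B {y}) ∈
        (⊤ : Submodule B (Submodule.span B {y})) := trivial
      rw [h, Submodule.mem_bot] at this
      exact congrArg Subtype.val this)⟩
  have hatom : IsAtom L := ⟨hL, fun L' hL' => by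
    by_contra h
    exact hmin L' h hL'⟩
  refine ⟨L.map (Submodule.subtype _), ?_, ?_⟩
  · exact (Submodule.map_subtype_le _ _).trans ((Submodule.span_singleton_le_iff_mem _ _).2 hyK)
  · exact ((OrderIso.isAtom_iff (Submodule.mapIic (Submodule.span B {y})) L).2
      hatom).of_isAtom_coe_Iic

end Decomposition

/-! ### Krull dimension and 1-critical modules. -/

section Critical

variable {A : Type u} [Ring A] {M : Type v} [AddCommGroup M] [Module A M]

/-- Krull dimension below 1 is the Artinian condition, carried to the interval above `N` by the
correspondence of submodules. -/
theorem kdimLT_one_quotient_iff (N : Submodule A M) :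
    KdimLT A 1 (M ⧸ N) ↔ ∀ c : ℕ → Submodule A M, Antitone c → (∀ i, N ≤ c i) →
      ∃ m, ∀ i, m ≤ i → c (i + 1) = c i := by
  constructor
  · intro h c hc hN
    obtain ⟨m, hm⟩ := h (fun i => (c i).map N.mkQ) (fun i j hij => Submodule.map_mono (hc hij))
      fun i => ⟨bot_le, le_top⟩
    refine ⟨m, fun i hi => ?_⟩
    have hci : (c (i + 1)).map N.mkQ = (c i).map N.mkQ := hm i hi
    have := congrArg (Submodule.comap N.mkQ) hci
    rwa [Submodule.comap_map_mkQ, Submodule.comap_map_mkQ, sup_eq_right.2 (hN _),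
      sup_eq_right.2 (hN _)] at this
  · intro h c hc _
    obtain ⟨m, hm⟩ := h (fun i => (c i).comap N.mkQ) (fun i j hij => Submodule.comap_mono (hc hij))
      fun i => by
        intro y hy
        rw [Submodule.mem_comap, Submodule.mkQ_apply, (Submodule.Quotient.mk_eq_zero N).2 hy]
        exact zero_mem _
    exact ⟨m, fun i hi => Submodule.comap_injective_of_surjective N.mkQ_surjective (hm i hi)⟩

/-- 1-critical modules are uniform. -/
theorem IsCriticalModule.inf_ne_bot (h : IsCriticalModule A 1 M) {N L : Submodule A M}
    (hN : N ≠ ⊥) (hL : L ≠ ⊥) : N ⊓ L ≠ ⊥ := by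
  intro hNL
  -- If `N ∩ L = 0`, then `N` embeds in the Artinian module `M/L`, and `M/N` is Artinian; so `M`
  -- would be Artinian.
  refine h.2.1 fun c hc _ => ?_
  obtain ⟨m, hm⟩ := (kdimLT_one_quotient_iff N).1 (h.2.2 N hN) (fun i => c i ⊔ N)
    (fun i j hij => sup_le_sup_right (hc hij) N) fun i => le_sup_right
  obtain ⟨m', hm'⟩ := (kdimLT_one_quotient_iff L).1 (h.2.2 L hL) (fun i => c i ⊓ N ⊔ L)
    (fun i j hij => sup_le_sup_right (inf_le_inf_right N (hc hij)) L) fun i => le_sup_right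
  refine ⟨max m m', fun i hi => ?_⟩
  have key : ∀ i, (c i ⊓ N ⊔ L) ⊓ N = c i ⊓ N := fun i => by
    rw [sup_inf_assoc_of_le L inf_le_right, inf_comm L N, hNL, sup_bot_eq]
  refine eq_of_le_of_inf_le_of_sup_le (z := N) (hc i.le_succ) ?_ ?_
  · rw [← key i, ← key (i + 1)]
    exact inf_le_inf_right N (hm' i (le_of_max_le_right hi)).ge
  · exact (hm i (le_of_max_le_left hi)).ge

/-- A criterion for 1-critical modules, by means of a normal element `x`. -/
theorem isCriticalModule_one {P : Type w} [Ring P] [IsDomain P] {π : A →+* P} {x : A}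
    (hP : ChainsStabilize P)
    (hπ : Function.Surjective π) (hx : π x = 0) (hl : ∀ a, π a = 0 → ∃ b, a = x * b)
    (hr : ∀ a, π a = 0 → ∃ b, a = b * x) {m : M} (hgen : ∀ y : M, ∃ a : A, y = a • m) {z : A}
    (hz : π z ≠ 0) (hzu : ¬ IsUnit (π z)) (hann : ∀ a : A, a • m = 0 ↔ ∃ b, a = b * z)
    (hxM : ∀ y : M, x • y = 0 → y = 0)
    (hess : ∀ y : M, y ≠ 0 → ∃ (a : A) (n : ℕ), a • y = x ^ n • m) : IsCriticalModule A 1 M := by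
  have hsw : ∀ a, ∃ a', x * a = a' * x := fun a => hr _ (by rw [map_mul, hx, zero_mul])
  have hsw' : ∀ a, ∃ a', a * x = x * a' := fun a => hl _ (by rw [map_mul, hx, mul_zero])
  have hsw'' : ∀ n a, ∃ a', a * x ^ n = x ^ n * a' := by
    intro n
    induction n with
    | zero => intro a; exact ⟨a, by simp⟩
    | succ n ih =>
      intro a
      obtain ⟨b, hb⟩ := hsw' a
      obtain ⟨d, hd⟩ := ih b
      exact ⟨d, by rw [pow_succ', ← mul_assoc, hb, mul_assoc, hd, mul_assoc]⟩
  -- Submodules containing `xM` are compared with the ideals of `P` containing `π z`.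
  have chain1 : ∀ c : ℕ → Submodule A M, Antitone c → (∀ i (y : M), x • y ∈ c i) →
      ∃ n, ∀ i, n ≤ i → c i = c n := by
    intro c hc hxc
    let I : ℕ → Ideal P := fun i =>
      { carrier := {p | ∃ a, π a = p ∧ a • m ∈ c i}
        zero_mem' := ⟨0, map_zero π, by simp⟩
        add_mem' := by
          rintro _ _ ⟨a, rfl, ha⟩ ⟨b, rfl, hb⟩
          exact ⟨a + b, map_add π a b, by rw [add_smul]; exact add_mem ha hb⟩
        smul_mem' := by
          rintro p _ ⟨a, rfl, ha⟩
          obtain ⟨b, rfl⟩ := hπ p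
          exact ⟨b * a, map_mul π b a, by rw [mul_smul]; exact (c i).smul_mem _ ha⟩ }
    obtain ⟨n, hn⟩ := hP (π z) hz I (fun i j hij p ⟨a, ha, ham⟩ => ⟨a, ha, hc hij ham⟩)
      fun i => ⟨z, rfl, by rw [(hann z).2 ⟨1, (one_mul z).symm⟩]; exact zero_mem _⟩
    refine ⟨n, fun i hi => le_antisymm (hc hi) fun y hy => ?_⟩
    obtain ⟨a, rfl⟩ := hgen y
    have hmem : π a ∈ I i := by
      rw [hn i hi]
      exact ⟨a, rfl, hy⟩
    obtain ⟨a', ha', ham⟩ := hmem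
    obtain ⟨b, hb⟩ := hl (a - a') (by rw [map_sub, ha', sub_self])
    rw [← sub_add_cancel a a', hb, add_smul, mul_smul]
    exact add_mem (hxc i _) ham
  have chain : ∀ (n : ℕ) (c : ℕ → Submodule A M), Antitone c → (∀ i (y : M), x ^ n • y ∈ c i) →
      ∃ n, ∀ i, n ≤ i → c i = c n := by
    intro n
    induction n with
    | zero =>
      intro c _ hxc
      have htop : ∀ i, c i = ⊤ := fun i => eq_top_iff.2 fun y _ => by simpa using hxc i y
      exact ⟨0, fun i _ => by rw [htop i, htop 0]⟩
    | succ n ih =>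
      intro c hc hxc
      -- A descending chain is controlled by its sums with `xM` and its preimages under `x`; the
      -- preimages contain `x^n M`, so induction applies.
      let d : ℕ → Submodule A M := fun i =>
        { carrier := {y | x • y ∈ c i}
          zero_mem' := by simp
          add_mem' := fun {a b} ha hb => by
            rw [Set.mem_ofPred_eq, smul_add]
            exact add_mem ha hb
          smul_mem' := fun a y hy => by
            obtain ⟨a', ha'⟩ := hsw a
            rw [Set.mem_ofPred_eq, ← mul_smul, ha', mul_smul]
            exact (c i).smul_mem _ hy }
      let X : Submodule A M :=
        { carrier := {y | ∃ y', y = x • y'}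
          zero_mem' := ⟨0, by simp⟩
          add_mem' := by
            rintro _ _ ⟨y, rfl⟩ ⟨y', rfl⟩
            exact ⟨y + y', by rw [smul_add]⟩
          smul_mem' := by
            rintro a _ ⟨y, rfl⟩
            obtain ⟨a', ha'⟩ := hsw' a
            exact ⟨a' • y, by rw [← mul_smul, ha', mul_smul]⟩ }
      obtain ⟨n₁, h₁⟩ := ih d (fun i j hij y hy => hc hij hy) fun i y => by
        change x • x ^ n • y ∈ c i
        rw [← mul_smul, ← pow_succ']
        exact hxc i y
      obtain ⟨n₂, h₂⟩ := chain1 (fun i => c i ⊔ X) (fun i j hij => sup_le_sup_right (hc hij) X)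
        fun i y => Submodule.mem_sup_right ⟨y, rfl⟩
      refine ⟨max n₁ n₂, fun i hi => le_antisymm (hc hi) fun y hy => ?_⟩
      have hy' : y ∈ c i ⊔ X := by
        have e1 : c i ⊔ X = c n₂ ⊔ X := h₂ i (le_of_max_le_right hi)
        have e2 : c (max n₁ n₂) ⊔ X = c n₂ ⊔ X := h₂ _ (le_max_right _ _)
        rw [e1, ← e2]
        exact Submodule.mem_sup_left hy
      obtain ⟨u, hu, _, ⟨w, rfl⟩, rfl⟩ := Submodule.mem_sup.1 hy'
      refine add_mem hu ?_
      have hw : w ∈ d (max n₁ n₂) := by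
        have := sub_mem hy (hc hi hu)
        rwa [add_sub_cancel_left] at this
      rw [h₁ _ (le_max_left _ _), ← h₁ i (le_of_max_le_left hi)] at hw
      exact hw
  -- By `hess` and normality of `x`, a nonzero submodule contains some `x^n M`.
  have hproper : ∀ N : Submodule A M, N ≠ ⊥ → KdimLT A 1 (M ⧸ N) := by
    intro N hN
    rw [kdimLT_one_quotient_iff]
    intro c hc hNc
    obtain ⟨y, hyN, hy⟩ := Submodule.exists_mem_ne_zero_of_ne_bot hN
    obtain ⟨a, n, han⟩ := hess y hy
    obtain ⟨n', hn'⟩ := chain n c hc fun i y' => by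
      obtain ⟨b, rfl⟩ := hgen y'
      obtain ⟨b', hb'⟩ := exists_pow_mul_eq hsw n b
      rw [← mul_smul, hb', mul_smul, ← han]
      exact hNc i (N.smul_mem _ (N.smul_mem _ hyN))
    exact ⟨n', fun i hi => by rw [hn' _ (by lia), hn' i hi]⟩
  refine ⟨?_, ?_, hproper⟩
  · intro c hc _
    have hint : ∀ i, c (i + 1) ≠ ⊥ → DevLT 1 (c (i + 1)) (c i) := fun i hi d hd hdc =>
      (kdimLT_one_quotient_iff _).1 (hproper _ hi) d hd fun j => (hdc j).1
    by_cases hbot : ∃ j, c j = ⊥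
    · obtain ⟨j, hj⟩ := hbot
      refine ⟨j, fun i hi d _ hdc => ⟨0, fun l _ => ?_⟩⟩
      have hci : c i = ⊥ := le_bot_iff.1 (hj ▸ hc hi)
      have hd : ∀ l, d l = ⊥ := fun l => le_bot_iff.1 (hci ▸ (hdc l).2)
      change d (l + 1) = d l
      rw [hd, hd]
    · push Not at hbot
      exact ⟨0, fun i _ => hint i (hbot _)⟩
  · intro hdev
    -- The chain `x^i M` never stops: otherwise `m = x a m` for some `a`, so `1 - x a ∈ Az` and `π
    -- z` would be a unit.
    let c : ℕ → Submodule A M := fun i =>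
      { carrier := {y | ∃ y', y = x ^ i • y'}
        zero_mem' := ⟨0, by simp⟩
        add_mem' := by
          rintro _ _ ⟨y, rfl⟩ ⟨y', rfl⟩
          exact ⟨y + y', by rw [smul_add]⟩
        smul_mem' := by
          rintro a _ ⟨y, rfl⟩
          obtain ⟨a', ha'⟩ := hsw'' i a
          exact ⟨a' • y, by rw [← mul_smul, ha', mul_smul]⟩ }
    obtain ⟨n, hn⟩ := hdev c (fun i j hij => by
      rintro _ ⟨y, rfl⟩
      obtain ⟨e, rfl⟩ := Nat.exists_eq_add_of_le hij
      exact ⟨x ^ e • y, by rw [← mul_smul, pow_add]⟩) fun i => ⟨bot_le, le_top⟩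
    have hcn : c (n + 1) = c n := hn n le_rfl
    have hmem : x ^ n • m ∈ c (n + 1) := by
      rw [hcn]
      exact ⟨m, rfl⟩
    obtain ⟨y, hy⟩ := hmem
    have hxn : ∀ (n : ℕ) (y : M), x ^ n • y = 0 → y = 0 := by
      intro n
      induction n with
      | zero => intro y hy; simpa using hy
      | succ n ih =>
        intro y hy
        rw [pow_succ, mul_smul] at hy
        exact hxM y (ih _ hy)
    have hmy : m = x • y := by
      refine sub_eq_zero.1 (hxn n _ ?_)
      rw [smul_sub, hy, ← mul_smul, ← pow_succ, sub_self]
    obtain ⟨a, rfl⟩ := hgen y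
    obtain ⟨b, hb⟩ := (hann (1 - x * a)).1 (by rw [sub_smul, one_smul, mul_smul, ← hmy, sub_self])
    have h1 : π b * π z = 1 := by
      rw [← map_mul, ← hb, map_sub, map_mul, hx, zero_mul, map_one, sub_zero]
    exact hzu ⟨⟨π z, π b, mul_eq_one_symm h1, h1⟩, rfl⟩

end Critical

/-! ### Restriction of scalars, and consequences for simple and torsion modules. -/

section Restriction

variable {A : Type u} {B : Type v} [Ring A] [Ring B] (f : A →+* B)
  {F : Type w} [AddCommGroup F] [Module B F]

/-- Keeps both actions on one type, so that scalars of `B` can act on elements of `A`-submodules. -/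
instance Restrict.moduleTarget (M : Type w) [AddCommGroup M] [Module B M] :
    Module B (Restrict f M) := inferInstanceAs (Module B M)

/-- A submodule, regarded as a submodule over the ring of the restricted scalars. -/
def Submodule.restrict (N : Submodule B F) : Submodule A (Restrict f F) where
  carrier := {y | (Restrict.of f F).symm y ∈ N}
  zero_mem' := N.zero_mem
  add_mem' := fun ha hb => N.add_mem ha hb
  smul_mem' := fun a _ hy => N.smul_mem (f a) hy

theorem Submodule.mem_restrict {N : Submodule B F} {y : F} :
    Restrict.of f F y ∈ N.restrict f ↔ y ∈ N := Iff.rfl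

theorem Submodule.restrict_injective :
    Function.Injective (Submodule.restrict f : Submodule B F → Submodule A (Restrict f F)) :=
  fun N L h => Submodule.ext fun y => by
    rw [← Submodule.mem_restrict f, h, Submodule.mem_restrict]

theorem Submodule.restrict_toAddSubmonoid (N : Submodule B F) :
    (N.restrict f).toAddSubmonoid = N.toAddSubmonoid := rfl

theorem Submodule.restrict_iSup {ι : Sort*} (N : ι → Submodule B F) :
    (⨆ i, N i).restrict f = ⨆ i, (N i).restrict f := by
  apply Submodule.toAddSubmonoid_injective
  rw [Submodule.restrict_toAddSubmonoid, Submodule.iSup_toAddSubmonoid,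
    Submodule.iSup_toAddSubmonoid]
  rfl

theorem Submodule.disjoint_restrict {N L : Submodule B F} :
    Disjoint (N.restrict f) (L.restrict f) ↔ Disjoint N L := by
  rw [Submodule.disjoint_def, Submodule.disjoint_def]
  rfl

theorem isDirectSumOf_restrict {ι : Type w} (N : ι → Submodule B F) :
    IsDirectSumOf (fun i => (N i).restrict f) ↔ IsDirectSumOf N := by
  have htop : (⊤ : Submodule B F).restrict f = ⊤ := rfl
  unfold IsDirectSumOf iSupIndep
  simp only [← Submodule.restrict_iSup, Submodule.disjoint_restrict, ← htop,
    (Submodule.restrict_injective f).eq_iff]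

end Restriction

/-- Kernel and image of a normal element are submodules, and faithfulness excludes the zero action.
-/
theorem bijective_smul_of_normal {A : Type u} {V : Type v} [Ring A] [AddCommGroup V] [Module A V]
    [IsSimpleModule A V] [FaithfulSMul A V] {x : A} (hx : x ≠ 0) (hl : ∀ a, ∃ a', x * a = a' * x)
    (hr : ∀ a, ∃ a', a * x = x * a') : Function.Bijective fun v : V => x • v := by
  have hne : ¬ ∀ v : V, x • v = 0 := fun h =>
    hx (FaithfulSMul.eq_of_smul_eq_smul (α := V) fun v => by rw [h v, zero_smul])
  constructor
  · let K : Submodule A V :=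
      { carrier := {v | x • v = 0}
        zero_mem' := smul_zero x
        add_mem' := fun {v w} hv hw => by
          rw [Set.mem_ofPred_eq, smul_add, hv, hw, add_zero]
        smul_mem' := fun a v hv => by
          obtain ⟨a', ha'⟩ := hl a
          rw [Set.mem_ofPred_eq, ← mul_smul, ha', mul_smul, hv, smul_zero] }
    have hK : K = ⊥ := (eq_bot_or_eq_top K).resolve_right fun h => hne fun v => by
      have : v ∈ K := h ▸ Submodule.mem_top
      exact this
    intro v w hvw
    have : v - w ∈ K := by
      change x • (v - w) = 0
      rw [smul_sub, sub_eq_zero]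
      exact hvw
    rw [hK, Submodule.mem_bot, sub_eq_zero] at this
    exact this
  · let K : Submodule A V :=
      { carrier := {v | ∃ w, x • w = v}
        zero_mem' := ⟨0, smul_zero x⟩
        add_mem' := by
          rintro _ _ ⟨v, rfl⟩ ⟨w, rfl⟩
          exact ⟨v + w, smul_add x v w⟩
        smul_mem' := by
          rintro a _ ⟨v, rfl⟩
          obtain ⟨a', ha'⟩ := hr a
          exact ⟨a' • v, by rw [← mul_smul, ← ha', mul_smul]⟩ }
    have hK : K = ⊤ := (eq_bot_or_eq_top K).resolve_left fun h => hne fun v => by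
      have : x • v ∈ K := ⟨v, rfl⟩
      rwa [h, Submodule.mem_bot] at this
    intro v
    have : v ∈ K := hK ▸ Submodule.mem_top
    exact this

namespace IsNormalLocalization

variable {A : Type u} {B : Type v} {P : Type w} [Ring A] [Ring B] [Ring P]
  {ι : A →+* B} {π : A →+* P} {x : A}

/-- Write `v = x w` and, by simplicity, `w = a v`; then `1 - x a` kills `v`. -/
theorem exists_smul_eq_zero_of_simple (H : IsNormalLocalization ι π x) {V : Type*} [AddCommGroup V]
    [Module A V] [IsSimpleModule A V] (hV : Function.Surjective fun v : V => x • v) (v : V) :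
    ∃ c, π c = 1 ∧ c • v = 0 := by
  by_cases hv : v = 0
  · exact ⟨1, map_one π, by rw [hv, smul_zero]⟩
  · obtain ⟨w, hw⟩ := hV v
    obtain ⟨a, rfl⟩ := IsSimpleModule.toSpanSingleton_surjective A hv w
    refine ⟨1 - x * a, by rw [map_sub, map_mul, H.map_eq_zero, zero_mul, map_one, sub_zero], ?_⟩
    rw [sub_smul, one_smul, mul_smul, sub_eq_zero]
    exact hw.symm

theorem isLocallyArtinian (H : IsNormalLocalization ι π x) [Nontrivial P] (hB : ChainsStabilize B)
    {M : Type*} [AddCommGroup M] [Module B M] (hM : ∀ m : M, ∃ c, π c = 1 ∧ ι c • m = 0) :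
    IsLocallyArtinian A (Restrict ι M) := by
  intro N hN
  induction N, hN using Submodule.fg_induction with
  | singleton y =>
    obtain ⟨c, hc, hcy⟩ := hM y
    refine isArtinian_span_singleton (B := B) (M := Restrict ι M) hB (fun a y => ⟨ι a, rfl⟩)
      (fun b y => H.exists_smul_eq_of_torsion hM b y) y (t := ι c) (fun h0 => ?_) hcy
    rw [map_eq_zero_iff ι H.injective] at h0
    rw [h0, map_zero] at hc
    exact zero_ne_one hc
  | sup N L _ _ hN hL => exact isArtinian_sup N L

/-- Clearing denominators turns essentiality over `B` into a statement over `A`: every nonzero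
element of `N` has a multiple `x^n m`. -/
theorem exists_map_smul_eq_pow_smul (H : IsNormalLocalization ι π x) {F : Type*}
    [AddCommGroup F] [Module B F] {N U : Submodule B F} (hU : IsAtom U)
    (hess : ∀ L ≤ N, Disjoint L U → L = ⊥) {m y : F} (hm : m ∈ U) (hy : y ∈ N) (hy0 : y ≠ 0) :
    ∃ (a : A) (n : ℕ), ι a • y = ι x ^ n • m := by
  have h1 : ¬ Disjoint (Submodule.span B {y}) U := fun hd => hy0 (by
    have := hess _ ((Submodule.span_singleton_le_iff_mem _ _).2 hy) hd
    rwa [Submodule.span_singleton_eq_bot] at this)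
  have h2 : Submodule.span B {y} ⊓ U = U :=
    (hU.le_iff.1 inf_le_right).resolve_left fun h => h1 (disjoint_iff.2 h)
  have h3 : m ∈ Submodule.span B {y} := by
    rw [← h2] at hm
    exact hm.1
  obtain ⟨b, rfl⟩ := Submodule.mem_span_singleton.1 h3
  obtain ⟨n, a, ha⟩ := H.exists_pow_mul b
  exact ⟨a, n, by rw [← mul_smul, ha]⟩

theorem exists_smul_smul_eq_of_isAtom {F : Type*} [AddCommGroup F] [Module B F]
    {U : Submodule B F} (hU : IsAtom U) {m : F} (hm : m ∈ U) (b : B) (hbm : b • m ≠ 0) :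
    ∃ b' : B, b' • b • m = m := by
  have h1 : Submodule.span B {b • m} = U :=
    (hU.le_iff.1 ((Submodule.span_singleton_le_iff_mem _ _).2 (U.smul_mem b hm))).resolve_left
      fun h => hbm (Submodule.span_singleton_eq_bot.1 h)
  rw [← h1] at hm
  exact Submodule.mem_span_singleton.1 hm

end IsNormalLocalization

/-! ### The Ore set `𝒞` and its irreducible factors. -/

section Setting

open Polynomial

variable {k : Type v} [Field k] {R : Type u} [CommRing R] [IsDomain R]
  [IsDiscreteValuationRing R] [Algebra k R] {α : R ≃ₐ[k] R}

/-- The reduction `S → κ[θ]`, on the opposite ring. -/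
def redOp (h : ∀ r, IsLocalRing.residue R ((α : R ≃+* R) r) = IsLocalRing.residue R r) :
    (RingS α)ᵐᵒᵖ →+* (IsLocalRing.ResidueField R)[X] :=
  (SkewPoly.red h).fromOpposite fun _ _ => Commute.all _ _

variable (h : ∀ r, IsLocalRing.residue R ((α : R ≃+* R) r) = IsLocalRing.residue R r)

omit [IsDomain R] [IsDiscreteValuationRing R] in
theorem coeff_autS (s : RingS α) (n : ℕ) :
    SkewPoly.coeff (autS α s) n = α (SkewPoly.coeff s n) :=
  SkewPoly.coeff_map _ _ s n

theorem redOp_op (s : RingS α) : redOp h (op s) = SkewPoly.red h s := rfl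

variable {x : R} (hx : IsLocalRing.maximalIdeal R = Ideal.span {x})

include hx

variable (α) in
theorem const_uniformizer_ne_zero :
    SkewPoly.const (α : R ≃+* R) x ≠ 0 := fun h0 => by
  have hx0 : x = 0 := by
    have := congrFun (congrArg SkewPoly.coeff h0) 0
    simpa [SkewPoly.coeff_const] using this
  refine IsDiscreteValuationRing.not_a_field R ?_
  rw [hx, hx0, Ideal.span_singleton_eq_bot]

/-- Passing to opposite rings exchanges the sides on which `X` is factored out. -/
theorem isNormalLocalization : IsNormalLocalization (RingHom.op (inclST α)) (redOp h)
    (op (SkewPoly.const (α : R ≃+* R) x)) where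
  injective := fun a b hab => unop_injective (inclST_injective (op_injective hab))
  map_eq_zero := SkewPoly.red_const_uniformizer h hx
  exists_eq_mul a ha := by
    obtain ⟨s, hs⟩ := SkewPoly.exists_eq_mul_const h hx ha
    exact ⟨op s, unop_injective hs⟩
  exists_eq_mul' a ha := by
    obtain ⟨s, hs⟩ := SkewPoly.exists_eq_const_mul h hx ha
    exact ⟨op s, unop_injective hs⟩
  isUnit := by
    change IsUnit (op (inclST α (SkewPoly.const (α : R ≃+* R) x)))
    rw [isUnit_op, inclST_const]
    refine IsUnit.map (SkewPoly.const (fracAut α)) (Ne.isUnit fun h0 => ?_)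
    rw [map_eq_zero_iff _ (IsFractionRing.injective R (FractionRing R))] at h0
    exact const_uniformizer_ne_zero α hx (by rw [h0, map_zero])
  exists_pow_mul b := by
    obtain ⟨n, s, hs⟩ := exists_mul_eq_inclST hx h (unop b)
    exact ⟨n, op s, unop_injective hs⟩
  exists_eq_pow_mul a ha := by
    obtain ⟨n, z, hz, hz0⟩ := SkewPoly.exists_eq_mul_const_pow h hx (f := unop a) (by simpa using ha)
    exact ⟨n, op z, unop_injective hz, hz0⟩

theorem mem_setC_iff (c : RingS α) : c ∈ setC α x ↔ SkewPoly.red h c = 1 := by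
  constructor
  · rintro ⟨s, rfl⟩
    rw [map_add, map_mul, SkewPoly.red_const_uniformizer h hx, zero_mul, map_one, add_zero]
  · intro hc
    obtain ⟨s, hs⟩ := SkewPoly.exists_eq_const_mul h hx (f := c - 1)
      (by rw [map_sub, hc, map_one, sub_self])
    exact ⟨s, by rw [← hs, add_sub_cancel]⟩

theorem ore_setC (r : (RingS α)ᵐᵒᵖ) (c : (RingS α)ᵐᵒᵖ) (hc : redOp h c = 1) :
    ∃ c' r', redOp h c' = 1 ∧ c' * r = r' * c :=
  have H := isNormalLocalization h hx
  exists_mul_eq_mul_of_normal H.map_eq_zero H.exists_eq_mul H.exists_eq_mul' r hc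

theorem ore_setC_left (r : RingS α) (c : RingS α) (hc : SkewPoly.red h c = 1) :
    ∃ c' r', SkewPoly.red h c' = 1 ∧ c' * r = r' * c :=
  exists_mul_eq_mul_of_normal (SkewPoly.red_const_uniformizer h hx)
    (fun _ => SkewPoly.exists_eq_const_mul h hx) (fun _ => SkewPoly.exists_eq_mul_const h hx) r hc

include h

theorem exists_submonoid_setC : ∃ M : Submonoid (RingS α), (M : Set (RingS α)) = setC α x ∧
    Nonempty (OreLocalization.OreSet M) ∧ Nonempty (OreLocalization.OreSet M.op) := by
  have hC : (MonoidHom.mker (SkewPoly.red h).toMonoidHom : Set (RingS α)) = setC α x :=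
    Set.ext fun c => (mem_setC_iff h hx c).symm
  refine ⟨_, hC, ?_, ?_⟩
  · rw [OreLocalization.nonempty_oreSet_iff_of_noZeroDivisors]
    rintro r ⟨c, hc⟩
    obtain ⟨c', r', hc', he⟩ := ore_setC_left h hx r c hc
    exact ⟨r', ⟨c', hc'⟩, he⟩
  · rw [OreLocalization.nonempty_oreSet_iff_of_noZeroDivisors]
    rintro r ⟨c, hc⟩
    obtain ⟨c', r', hc', he⟩ := ore_setC h hx r c hc
    exact ⟨r', ⟨c', hc'⟩, he⟩

theorem autS_image_setC : autS α '' setC α x = setC α x := by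
  have hred : ∀ s, SkewPoly.red h (autS α s) = SkewPoly.red h s := fun s =>
    Polynomial.ext fun n => by
      rw [SkewPoly.coeff_red, SkewPoly.coeff_red, coeff_autS]
      exact h _
  have hsurj : ∀ s, ∃ s', autS α s' = s := fun s => by
    obtain ⟨s', hs'⟩ := SkewPoly.exists_coeff_eq (α : R ≃+* R)
      (fun n => (α : R ≃+* R).symm (SkewPoly.coeff s n)) (SkewPoly.size s)
    refine ⟨s', SkewPoly.ext fun n => ?_⟩
    rw [coeff_autS, hs']
    split_ifs with hn
    · exact (α : R ≃+* R).apply_symm_apply _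
    · rw [map_zero, SkewPoly.degLT_size s n (not_lt.1 hn)]
  ext c
  constructor
  · rintro ⟨d, hd, rfl⟩
    rw [mem_setC_iff h hx] at hd ⊢
    rw [hred, hd]
  · intro hc
    obtain ⟨d, rfl⟩ := hsurj c
    refine ⟨d, ?_, rfl⟩
    rw [mem_setC_iff h hx] at hc ⊢
    rw [← hred, hc]

/-- Irreducible elements that are units modulo `X` have type (B). -/
theorem isTypeB_of_isUnit_red {z : RingS α} (hz : Irreducible z) (hu : IsUnit (SkewPoly.red h z)) :
    IsTypeB α x z := by
  obtain ⟨c, hc, hcz⟩ := Polynomial.isUnit_iff.1 hu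
  obtain ⟨r, hr⟩ := IsLocalRing.residue_surjective (R := R) (c⁻¹)
  have hru : IsUnit r := by
    by_contra hn
    rw [← mem_nonunits_iff, ← IsLocalRing.mem_maximalIdeal, ← IsLocalRing.residue_eq_zero_iff, hr,
      inv_eq_zero] at hn
    exact hc.ne_zero hn
  obtain ⟨e, rfl⟩ := hru
  have hred : SkewPoly.red h (SkewPoly.const (α : R ≃+* R) (e : R) * z) = 1 := by
    rw [map_mul, SkewPoly.red_const, hr, ← hcz, ← C_mul, inv_mul_cancel₀ hc.ne_zero, C_1]
  obtain ⟨s, hs⟩ := (mem_setC_iff h hx _).2 hred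
  refine ⟨hz, e, s, ?_, hs⟩
  -- If `s` were in `R`, then `1 + X s` would be a unit of the local ring `R`, and `z` a unit.
  rintro ⟨r, rfl⟩
  refine hz.not_isUnit ?_
  have heu : IsUnit (SkewPoly.const (α : R ≃+* R) (e : R)) := e.isUnit.map _
  have hez : IsUnit (SkewPoly.const (α : R ≃+* R) (e : R) * z) := by
    rw [hs, ← map_mul, ← map_one (SkewPoly.const (α : R ≃+* R)), ← map_add]
    refine IsUnit.map _ ?_
    by_contra hn
    rw [← mem_nonunits_iff, ← IsLocalRing.mem_maximalIdeal, hx, Ideal.mem_span_singleton] at hn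
    have h1 : x ∣ 1 := (dvd_add_left (dvd_mul_right x r)).1 hn
    refine (IsLocalRing.maximalIdeal.isMaximal R).ne_top ?_
    rw [hx, Ideal.span_singleton_eq_top]
    exact isUnit_of_dvd_one h1
  obtain ⟨u, hu⟩ := heu
  rw [← hu] at hez
  exact (Units.isUnit_units_mul u z).1 hez

/-- The reductions of the factors multiply to 1 in a commutative ring, so each is a unit. -/
theorem isTypeB_of_prod_mem {c : RingS α} (hc : c ∈ setC α x) (l : List (RingS α))
    (hl : ∀ z ∈ l, Irreducible z) (hlc : l.prod = c) : ∀ z ∈ l, IsTypeB α x z := by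
  intro z hz
  refine isTypeB_of_isUnit_red h hx (hl z hz) ?_
  rw [mem_setC_iff h hx, ← hlc, map_list_prod] at hc
  exact isUnit_of_dvd_one (hc ▸ List.dvd_prod (List.mem_map_of_mem hz))

end Setting

/-! ### Recognizing types (B) and (C). -/

section Setting

open Polynomial

variable {k : Type v} [Field k] {R : Type u} [CommRing R] [IsDomain R]
  [IsDiscreteValuationRing R] [Algebra k R] {α : R ≃ₐ[k] R}

theorem irreducible_unop {A : Type u} [Monoid A] {z : Aᵐᵒᵖ} (hz : Irreducible z) :
    Irreducible (unop z) where
  not_isUnit hu := hz.not_isUnit (isUnit_unop.1 hu)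
  isUnit_or_isUnit a b hab :=
    (hz.isUnit_or_isUnit (a := op b) (b := op a) (unop_injective hab)).symm.imp isUnit_op.1
      isUnit_op.1

omit [IsDomain R] [IsDiscreteValuationRing R] in
theorem nonempty_equiv_cyclicS {M : Type w} [AddCommGroup M] [Module (RingS α)ᵐᵒᵖ M] {m : M}
    (hgen : ∀ y : M, ∃ a : (RingS α)ᵐᵒᵖ, y = a • m) {z : (RingS α)ᵐᵒᵖ}
    (hann : ∀ a : (RingS α)ᵐᵒᵖ, a • m = 0 ↔ ∃ b, a = b * z) :
    Nonempty (M ≃ₗ[(RingS α)ᵐᵒᵖ] cyclicS α (unop z)) := by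
  let g : RingS α →ₗ[(RingS α)ᵐᵒᵖ] M :=
    { toFun := fun s => op s • m
      map_add' := fun s t => by rw [op_add, add_smul]
      map_smul' := fun a s => by
        rw [RingHom.id_apply, ← mul_smul]
        rfl }
  have hg : Function.Surjective g := fun y => by
    obtain ⟨a, rfl⟩ := hgen y
    exact ⟨unop a, rfl⟩
  have hker : LinearMap.ker g = Submodule.span (RingS α)ᵐᵒᵖ {unop z} := by
    ext s
    rw [LinearMap.mem_ker, Submodule.mem_span_singleton]
    change op s • m = 0 ↔ _
    rw [hann]
    constructor
    · rintro ⟨b, hb⟩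
      exact ⟨b, op_injective hb.symm⟩
    · rintro ⟨b, rfl⟩
      exact ⟨b, rfl⟩
  exact ⟨((Submodule.quotEquivOfEq _ _ hker.symm).trans (g.quotKerEquivOfSurjective hg)).symm⟩

theorem chainsStabilize_ringT (α : R ≃ₐ[k] R) : ChainsStabilize (RingT α)ᵐᵒᵖ := by
  refine chainsStabilize_of_degree (fun f => SkewPoly.size (unop f) - 1) (fun a b hab => ?_)
    fun a ha ha1 => ?_
  · have ha : unop a ≠ 0 := fun h0 => hab (by rw [(unop_eq_zero_iff a).1 h0, zero_mul])
    have hb : unop b ≠ 0 := fun h0 => hab (by rw [(unop_eq_zero_iff b).1 h0, mul_zero])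
    have h1 := (SkewPoly.size_mul hb ha).2
    obtain ⟨m, hm, -⟩ := SkewPoly.exists_size_eq ha
    obtain ⟨n, hn, -⟩ := SkewPoly.exists_size_eq hb
    rw [unop_mul]
    lia
  · obtain ⟨m, hm, -⟩ := SkewPoly.exists_size_eq (f := unop a) (by simpa using ha)
    exact isUnit_unop.1 (SkewPoly.isUnit_of_size_eq_one (by lia))

theorem chainsStabilize_polynomial (K : Type u) [Field K] : ChainsStabilize K[X] := by
  refine chainsStabilize_of_degree Polynomial.natDegree (fun a b hab => ?_) fun a ha ha1 => ?_
  · exact natDegree_mul (left_ne_zero_of_mul hab) (right_ne_zero_of_mul hab)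
  · rw [eq_C_of_natDegree_eq_zero ha1] at ha ⊢
    exact isUnit_C.2 (Ne.isUnit fun h0 => ha (by rw [h0, C_0]))

variable (h : ∀ r, IsLocalRing.residue R ((α : R ≃+* R) r) = IsLocalRing.residue R r)
  {x : R} (hx : IsLocalRing.maximalIdeal R = Ideal.span {x})

include hx in
/-- Simple `𝒞`-torsion modules have type (B). -/
theorem isTypeBModule_of_torsion {D : Type w} [AddCommGroup D] [Module (RingS α)ᵐᵒᵖ D]
    [IsSimpleModule (RingS α)ᵐᵒᵖ D] (hD : ∀ d : D, ∃ c, redOp h c = 1 ∧ c • d = 0) :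
    IsTypeBModule α x D := by
  have H := isNormalLocalization h hx
  -- A torsion element satisfies `d = a x d` and `d = x b d` for suitable `a` and `b`; so `x` is
  -- bijective and `D` becomes a `T`-module.
  have hbij : Function.Bijective fun d : D => op (SkewPoly.const (α : R ≃+* R) x) • d := by
    constructor
    · intro d e hde
      rw [← sub_eq_zero]
      obtain ⟨c, hc, hcd⟩ := hD (d - e)
      obtain ⟨a, ha⟩ := H.exists_eq_mul' (1 - c) (by rw [map_sub, hc, map_one, sub_self])
      have h1 : (1 - c) • (d - e) = d - e := by rw [sub_smul, hcd, one_smul, sub_zero]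
      rw [← h1, ha, mul_smul, smul_sub]
      have : op (SkewPoly.const (α : R ≃+* R) x) • d = op (SkewPoly.const (α : R ≃+* R) x) • e := hde
      rw [this, sub_self, smul_zero]
    · intro d
      obtain ⟨c, hc, hcd⟩ := hD d
      obtain ⟨a, ha⟩ := H.exists_eq_mul (1 - c) (by rw [map_sub, hc, map_one, sub_self])
      exact ⟨a • d, by
        change _ • a • d = d
        rw [← mul_smul, ← ha, sub_smul, hcd, one_smul, sub_zero]⟩
  obtain ⟨inst, hinst⟩ := H.exists_module hbij
  have := IsSimpleModule.nontrivial (RingS α)ᵐᵒᵖ D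
  obtain ⟨d, hd⟩ := exists_ne (0 : D)
  have hgen : ∀ {e : D}, e ≠ 0 → ∀ y : D, ∃ a : (RingS α)ᵐᵒᵖ, y = a • e := fun he y => by
    obtain ⟨a, ha⟩ := IsSimpleModule.toSpanSingleton_surjective (RingS α)ᵐᵒᵖ he y
    exact ⟨a, ha.symm⟩
  obtain ⟨c, hc, hcd⟩ := hD d
  obtain ⟨z, hz, hirr, hann⟩ := H.exists_irreducible_annihilator hd (fun b hb => by
    obtain ⟨a, ha⟩ := hgen hb d
    exact ⟨RingHom.op (inclST α) a, by rw [hinst]; exact ha.symm⟩)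
    (t := RingHom.op (inclST α) c) (fun h0 => by
      rw [map_eq_zero_iff _ H.injective] at h0
      rw [h0, map_zero] at hc
      exact zero_ne_one hc) (by rw [hinst, hcd])
  have hann' : ∀ a : (RingS α)ᵐᵒᵖ, a • d = 0 ↔ ∃ b, a = b * z := fun a => by
    rw [← hinst, hann]
  -- An element of `𝒞` is a multiple of `z`, so the reduction of `z` divides 1.
  obtain ⟨b, hb⟩ := (hann' c).1 hcd
  refine ⟨unop z, isTypeB_of_isUnit_red h hx (irreducible_unop hirr) ?_,
    nonempty_equiv_cyclicS (hgen hd) hann'⟩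
  rw [hb, map_mul] at hc
  exact IsUnit.of_mul_eq_one _ ((mul_comm _ _).trans hc)

theorem red_polyS (f : k[X]) :
    SkewPoly.red h (polyS α f) = f.map (algebraMap k (IsLocalRing.ResidueField R)) := by
  rw [polyS, Polynomial.sum_def, map_sum]
  conv_rhs => rw [f.as_sum_support_C_mul_X_pow, Polynomial.map_sum]
  refine Finset.sum_congr rfl fun i _ => ?_
  rw [map_mul, map_pow, SkewPoly.red_const, SkewPoly.red_theta, Polynomial.map_mul,
    Polynomial.map_pow, map_C, map_X]
  rfl

variable (hk : Function.Surjective (algebraMap k (IsLocalRing.ResidueField R)))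

include hk in
theorem red_surjective : Function.Surjective (SkewPoly.red h) := fun p => by
  obtain ⟨f, rfl⟩ := Polynomial.map_surjective _ hk p
  exact ⟨_, red_polyS h f⟩

include hx hk in
theorem isTypeC_of_not_isUnit_red {z : RingS α} (hz : Irreducible z) (h0 : SkewPoly.red h z ≠ 0)
    (hu : ¬ IsUnit (SkewPoly.red h z))
    (hθ : ∀ e : Rˣ, SkewPoly.const (α : R ≃+* R) e * z ≠ SkewPoly.theta (α : R ≃+* R)) :
    IsTypeC α x z := by
  set p := SkewPoly.red h z with hp
  obtain ⟨a, ha⟩ := hk (p.leadingCoeff)⁻¹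
  have hlc : p.leadingCoeff ≠ 0 := leadingCoeff_ne_zero.2 h0
  have ha0 : a ≠ 0 := by
    rintro rfl
    rw [map_zero] at ha
    exact inv_ne_zero hlc ha.symm
  obtain ⟨f, hf⟩ := Polynomial.map_surjective _ hk (C (p.leadingCoeff)⁻¹ * p)
  have hinj : Function.Injective (algebraMap k (IsLocalRing.ResidueField R)) :=
    (algebraMap k (IsLocalRing.ResidueField R)).injective
  obtain ⟨e, he⟩ := (ha0.isUnit).map (algebraMap k R)
  have hmonic : f.Monic := by
    rw [← Polynomial.monic_map_iff (f := algebraMap k (IsLocalRing.ResidueField R)), hf]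
    rw [mul_comm]
    exact monic_mul_leadingCoeff_inv h0
  have hdeg : f.natDegree = p.natDegree := by
    rw [← natDegree_map_eq_of_injective hinj f, hf, natDegree_C_mul (inv_ne_zero hlc)]
  have hpos : 0 < f.natDegree := by
    rw [hdeg]
    by_contra hn
    have hn : p.natDegree = 0 := by lia
    refine hu ?_
    rw [eq_C_of_natDegree_eq_zero hn] at h0 ⊢
    exact isUnit_C.2 (Ne.isUnit fun h1 => h0 (by rw [h1, C_0]))
  obtain ⟨s, hs⟩ := SkewPoly.exists_eq_const_mul h hx
    (f := SkewPoly.const (α : R ≃+* R) (e : R) * z - polyS α f) (by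
      rw [map_sub, red_polyS, map_mul, SkewPoly.red_const, hf, he, sub_eq_zero, ← hp, ← ha]
      rfl)
  exact ⟨hz, ⟨e, f, s, hmonic, hpos, by rw [← hs, add_sub_cancel]⟩, hθ⟩

end Setting

/-! ### Comparison of hulls over `S` and over `T`. -/

section Setting

variable {k : Type v} [Field k] {R : Type u} [CommRing R] [IsDomain R]
  [IsDiscreteValuationRing R] [Algebra k R] {α : R ≃ₐ[k] R}
  (h : ∀ r, IsLocalRing.residue R ((α : R ≃+* R) r) = IsLocalRing.residue R r)
  {x : R} (hx : IsLocalRing.maximalIdeal R = Ideal.span {x})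

include h hx

theorem IsDivisibleSubmodule.injective_restrict {F : Type u} [AddCommGroup F]
    [Module (RingT α)ᵐᵒᵖ F] {N : Submodule (RingT α)ᵐᵒᵖ F}
    (hN : IsDivisibleSubmodule (RingT α)ᵐᵒᵖ N) :
    Module.Injective (RingS α)ᵐᵒᵖ (N.restrict (RingHom.op (inclST α))) := by
  have H := isNormalLocalization h hx
  refine injective_of_divisible H.injective H.mul_comm_left H.isUnit H.exists_pow_mul
    (fun y hy => Subtype.ext ?_) fun a ha y => ?_
  · exact H.eq_zero_of_smul_eq_zero (M := F) (congrArg Subtype.val hy)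
  · obtain ⟨y', hy', hay⟩ := hN (RingHom.op (inclST α) a)
      ((map_ne_zero_iff _ H.injective).2 ha) y.1 y.2
    exact ⟨⟨y', hy'⟩, Subtype.ext hay⟩

theorem injective_asS {F : Type u} [AddCommGroup F] [Module (RingT α)ᵐᵒᵖ F]
    (hdiv : ∀ b : (RingT α)ᵐᵒᵖ, b ≠ 0 → ∀ y : F, ∃ y', b • y' = y) :
    Module.Injective (RingS α)ᵐᵒᵖ (AsS α F) := by
  have H := isNormalLocalization h hx
  refine injective_of_divisible H.injective H.mul_comm_left H.isUnit H.exists_pow_mul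
    (fun y hy => ?_) fun a ha y => ?_
  · exact H.eq_zero_of_smul_eq_zero (M := F) hy
  · exact hdiv (RingHom.op (inclST α) a) ((map_ne_zero_iff _ H.injective).2 ha) y

variable (hk : Function.Surjective (algebraMap k (IsLocalRing.ResidueField R)))

include hk in
/-- Restriction of the injective hull of a simple `T`-module without `𝒞`-torsion. -/
theorem exists_isTypeCCritical {F : Type u} [AddCommGroup F] [Module (RingT α)ᵐᵒᵖ F]
    (htor : ∀ y : F, ∃ b : (RingT α)ᵐᵒᵖ, b ≠ 0 ∧ b • y = 0)
    (hC : ∀ (y : F) (c : (RingS α)ᵐᵒᵖ), redOp h c = 1 → RingHom.op (inclST α) c • y = 0 → y = 0)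
    (hθ : ∀ y : F, RingHom.op (inclST α) (op (SkewPoly.theta (α : R ≃+* R))) • y = 0 → y = 0)
    {N : Submodule (RingT α)ᵐᵒᵖ F} (hN : IsDivisibleSubmodule (RingT α)ᵐᵒᵖ N)
    (hNU : HasSimpleEssential N) :
    ∃ U : Submodule (RingS α)ᵐᵒᵖ (N.restrict (RingHom.op (inclST α))),
      IsTypeCCritical α x U ∧ IsInjectiveHull (RingS α)ᵐᵒᵖ U.subtype := by
  have H := isNormalLocalization h hx
  obtain ⟨U, hUN, hU, hess⟩ := hNU
  obtain ⟨m, hmU, hm⟩ := Submodule.exists_mem_ne_zero_of_ne_bot hU.1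
  obtain ⟨t, ht, htm⟩ := htor m
  obtain ⟨z, hz, hirr, hann⟩ := H.exists_irreducible_annihilator hm
    (IsNormalLocalization.exists_smul_smul_eq_of_isAtom hU hmU) ht htm
  have hessm : ∀ y ∈ N, y ≠ 0 → ∃ (a : (RingS α)ᵐᵒᵖ) (n : ℕ), RingHom.op (inclST α) a • y =
      RingHom.op (inclST α) (op (SkewPoly.const (α : R ≃+* R) x)) ^ n • m := fun y hy hy0 =>
    H.exists_map_smul_eq_pow_smul hU hess hmU hy hy0
  let N' := N.restrict (RingHom.op (inclST α))
  let m' : N' := ⟨m, hUN hmU⟩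
  let U' : Submodule (RingS α)ᵐᵒᵖ N' := Submodule.span (RingS α)ᵐᵒᵖ {m'}
  let m'' : U' := ⟨m', Submodule.mem_span_singleton_self m'⟩
  have hm'' : m'' ≠ 0 := fun h0 => hm (congrArg (fun y : U' => y.1.1) h0)
  have hgen : ∀ y : U', ∃ a : (RingS α)ᵐᵒᵖ, y = a • m'' := fun y => by
    obtain ⟨a, ha⟩ := Submodule.mem_span_singleton.1 y.2
    exact ⟨a, Subtype.ext ha.symm⟩
  have hval : ∀ (a : (RingS α)ᵐᵒᵖ) (y : N'), (a • y).1 = RingHom.op (inclST α) a • (y.1 : F) :=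
    fun _ _ => rfl
  have hann' : ∀ a : (RingS α)ᵐᵒᵖ, a • m'' = 0 ↔ ∃ b, a = b * z := fun a => by
    rw [← hann]
    constructor
    · exact fun h0 => congrArg (fun y : U' => y.1.1) h0
    · exact fun h0 => Subtype.ext (Subtype.ext h0)
  have hessN : ∀ y : N', y ≠ 0 → ∃ (a : (RingS α)ᵐᵒᵖ) (n : ℕ),
      a • y = op (SkewPoly.const (α : R ≃+* R) x) ^ n • m' := fun y hy => by
    obtain ⟨a, n, han⟩ := hessm y.1 y.2 fun h0 => hy (Subtype.ext h0)
    refine ⟨a, n, Subtype.ext ?_⟩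
    rw [hval, hval, map_pow]
    exact han
  -- If `z` were a unit modulo `X`, a multiple of `z` would lie in `𝒞` and kill `m`.
  have hzu : ¬ IsUnit (redOp h z) := by
    rintro ⟨v, hv⟩
    obtain ⟨s, hs⟩ := red_surjective h hk (↑v⁻¹)
    refine hm (hC m (op s * z) ?_ ((hann _).2 ⟨_, rfl⟩))
    rw [map_mul, redOp_op, hs, ← hv, Units.inv_mul]
  have hxN : ∀ y : U', op (SkewPoly.const (α : R ≃+* R) x) • y = 0 → y = 0 := fun y hy =>
    Subtype.ext (Subtype.ext (H.eq_zero_of_smul_eq_zero (M := F)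
      (congrArg (fun y : U' => y.1.1) hy)))
  refine ⟨U', ⟨Module.Finite.span_singleton _ _, ?_, unop z, ?_, ?_⟩,
    hN.injective_restrict h hx, Submodule.subtype_injective _, ?_⟩
  · refine isCriticalModule_one (π := redOp h) (x := op (SkewPoly.const (α : R ≃+* R) x))
      (chainsStabilize_polynomial _) (fun p => ?_) H.map_eq_zero H.exists_eq_mul H.exists_eq_mul'
      hgen hz hzu hann' hxN fun y hy => ?_
    · obtain ⟨s, hs⟩ := red_surjective h hk p
      exact ⟨op s, hs⟩
    · obtain ⟨a, n, han⟩ := hessN y.1 fun h0 => hy (Subtype.ext h0)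
      exact ⟨a, n, Subtype.ext han⟩
  · refine isTypeC_of_not_isUnit_red h hx hk (irreducible_unop hirr) hz hzu fun e he => hm ?_
    have hθm : op (SkewPoly.const (α : R ≃+* R) (e : R) * unop z) =
        op (SkewPoly.theta (α : R ≃+* R)) := congrArg op he
    have hθ' : op (SkewPoly.theta (α : R ≃+* R)) = z * op (SkewPoly.const (α : R ≃+* R) (e : R)) :=
      hθm.symm
    have hzθ : z = op (SkewPoly.theta (α : R ≃+* R)) *
        op (SkewPoly.const (α : R ≃+* R) ((e⁻¹ : Rˣ) : R)) := by
      rw [hθ', mul_assoc, ← op_mul, ← map_mul, Units.inv_mul, map_one, op_one, mul_one]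
    have hzm : RingHom.op (inclST α) z • m = 0 := (hann z).2 ⟨1, (one_mul z).symm⟩
    rw [hzθ, map_mul, mul_smul] at hzm
    have heu : IsUnit (op (SkewPoly.const (α : R ≃+* R) ((e⁻¹ : Rˣ) : R))) :=
      isUnit_op.2 ((e⁻¹).isUnit.map _)
    exact (heu.map (RingHom.op (inclST α))).smul_eq_zero.1 (hθ _ hzm)
  · obtain ⟨eq⟩ := nonempty_equiv_cyclicS (α := α) (M := U') hgen hann'
    refine ⟨⊤, ⊤, fun h0 => hm'' ?_,
      ⟨Submodule.topEquiv.trans (eq.trans Submodule.topEquiv.symm)⟩⟩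
    have : m'' ∈ (⊤ : Submodule (RingS α)ᵐᵒᵖ U') := Submodule.mem_top
    rwa [h0, Submodule.mem_bot] at this
  -- A nonzero `y ∈ L` has a multiple `x^n m`, which lies in `U'` and is nonzero because `x` acts
  -- invertibly on `F`.
  · intro L hL
    by_contra hL0
    obtain ⟨y, hyL, hy⟩ := Submodule.exists_mem_ne_zero_of_ne_bot hL0
    obtain ⟨a, n, han⟩ := hessN y hy
    have hmem : a • y ∈ L ⊓ LinearMap.range U'.subtype := by
      refine ⟨L.smul_mem a hyL, ?_⟩
      rw [Submodule.range_subtype, han]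
      exact U'.smul_mem _ (Submodule.mem_span_singleton_self m')
    rw [hL, Submodule.mem_bot, han] at hmem
    refine hm (H.eq_zero_of_pow_smul_eq_zero (M := F) (n := n) ?_)
    rw [← map_pow]
    exact congrArg Subtype.val hmem

/-- Decompositions of type (C) are decompositions over `T`. -/
theorem exists_isSimpleHullDecomposition {F : Type u} [AddCommGroup F] [Module (RingT α)ᵐᵒᵖ F]
    (htor : ∀ y : F, ∃ b : (RingT α)ᵐᵒᵖ, b ≠ 0 ∧ b • y = 0) {ι : Type u}
    (N : ι → Submodule (RingS α)ᵐᵒᵖ (AsS α F)) (hN : IsTypeCDecomposition α x N) :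
    ∃ N' : ι → Submodule (RingT α)ᵐᵒᵖ F,
      (∀ i y, y ∈ N' i ↔ Restrict.of (RingHom.op (inclST α)) F y ∈ N i) ∧
      IsSimpleHullDecomposition N' := by
  have H := isNormalLocalization h hx
  have hdiv : ∀ i (a : (RingS α)ᵐᵒᵖ), a ≠ 0 → ∀ y ∈ N i, ∃ y' ∈ N i, a • y' = y := by
    intro i a ha y hy
    obtain ⟨U, -, hinj, -⟩ := hN.2 i
    obtain ⟨y', hy'⟩ := exists_smul_eq_of_injective hinj ha ⟨y, hy⟩
    exact ⟨y', y'.2, congrArg Subtype.val hy'⟩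
  -- Injectivity over `S` makes `N i` divisible. Since quotients by powers of `X` are unique in `F`,
  -- those found inside `N i` are the ones given by `T`.
  have hsmul : ∀ i (b : (RingT α)ᵐᵒᵖ) (y : AsS α F), y ∈ N i → b • y ∈ N i := by
    intro i b y hy
    obtain ⟨n, a, ha⟩ := H.exists_pow_mul b
    obtain ⟨y', hy', hxy⟩ := hdiv i (op (SkewPoly.const (α : R ≃+* R) x) ^ n)
      (pow_ne_zero n H.ne_zero) (a • y) ((N i).smul_mem a hy)
    have hby : b • y - y' = 0 := by
      refine H.eq_zero_of_pow_smul_eq_zero (M := AsS α F) (n := n) ?_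
      have h1 : RingHom.op (inclST α) (op (SkewPoly.const (α : R ≃+* R) x) ^ n) • y' =
        RingHom.op (inclST α) a • y := hxy
      rw [smul_sub, ← mul_smul, ha, ← h1, map_pow, sub_self]
    rw [sub_eq_zero.1 hby]
    exact hy'
  let N' : ι → Submodule (RingT α)ᵐᵒᵖ F := fun i =>
    { carrier := {y | Restrict.of (RingHom.op (inclST α)) F y ∈ N i}
      zero_mem' := (N i).zero_mem
      add_mem' := fun ha hb => (N i).add_mem ha hb
      smul_mem' := fun b y hy => hsmul i b y hy }
  refine ⟨N', fun i y => Iff.rfl, (isDirectSumOf_restrict (RingHom.op (inclST α)) N').1 hN.1,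
    fun i => ?_⟩
  have hN'div : IsDivisibleSubmodule (RingT α)ᵐᵒᵖ (N' i) := by
    intro b hb y hy
    obtain ⟨n, a, ha⟩ := H.exists_pow_mul b
    have ha0 : a ≠ 0 := by
      rintro rfl
      rw [map_zero] at ha
      exact mul_ne_zero (H.isUnit.pow n).ne_zero hb ha
    obtain ⟨y', hy', hay⟩ := hdiv i a ha0
      (op (SkewPoly.const (α : R ≃+* R) x) ^ n • Restrict.of (RingHom.op (inclST α)) F y)
      ((N i).smul_mem _ hy)
    have key : ∀ y' : F, RingHom.op (inclST α) a • y' = RingHom.op (inclST α)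
        (op (SkewPoly.const (α : R ≃+* R) x) ^ n) • y → b • y' = y := fun y' h1 => by
      refine sub_eq_zero.1 (H.eq_zero_of_pow_smul_eq_zero (n := n) ?_)
      rw [smul_sub, ← mul_smul, ha, ← map_pow, sub_eq_zero, h1]
    exact ⟨y', hy', key y' hay⟩
  obtain ⟨V, ⟨-, hcrit, -⟩, -, -, hVess⟩ := hN.2 i
  have hV0 : ∃ v : V, v ≠ 0 := by
    by_contra! hV
    refine hcrit.2.1 fun c _ _ => ⟨0, fun j _ => ?_⟩
    exact Submodule.ext fun y => by rw [hV y]; simp only [zero_mem]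
  have hnt : (⊤ : Submodule (RingT α)ᵐᵒᵖ (N' i)) ≠ ⊥ := fun h0 => by
    obtain ⟨v, hv⟩ := hV0
    have : (⟨v.1.1, v.1.2⟩ : N' i) ∈ (⊤ : Submodule (RingT α)ᵐᵒᵖ (N' i)) := Submodule.mem_top
    rw [h0, Submodule.mem_bot] at this
    exact hv (Subtype.ext (Subtype.ext (congrArg Subtype.val this)))
  obtain ⟨U, -, hU⟩ := exists_isAtom_le (chainsStabilize_ringT α) (F := N' i) (fun y => by
    obtain ⟨b, hb, hby⟩ := htor y
    exact ⟨b, hb, Subtype.ext hby⟩) ⊤ hnt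
  refine ⟨U, isSimpleModule_iff_isAtom.2 hU, hN'div.injective, Submodule.subtype_injective _,
    fun L hL => ?_⟩
  let r : Submodule (RingT α)ᵐᵒᵖ (N' i) → Submodule (RingS α)ᵐᵒᵖ (N i) := fun L =>
    { carrier := {y | (⟨y.1, y.2⟩ : N' i) ∈ L}
      zero_mem' := L.zero_mem
      add_mem' := fun ha hb => L.add_mem ha hb
      smul_mem' := fun a y hy => L.smul_mem (RingHom.op (inclST α) a) hy }
  have hr : ∀ L, L ≠ ⊥ → (r L).comap V.subtype ≠ ⊥ := by
    intro L hL0 hcomap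
    obtain ⟨y, hyL, hy⟩ := Submodule.exists_mem_ne_zero_of_ne_bot hL0
    have hrL : r L ≠ ⊥ := fun h0 => by
      have : (⟨y.1, y.2⟩ : N i) ∈ r L := hyL
      rw [h0, Submodule.mem_bot] at this
      exact hy (Subtype.ext (congrArg Subtype.val this))
    refine hrL (hVess _ (eq_bot_iff.2 ?_))
    rintro _ ⟨hv, v, rfl⟩
    have : v ∈ (r L).comap V.subtype := hv
    rw [hcomap, Submodule.mem_bot] at this
    rw [this, map_zero]
    exact zero_mem _
  -- Nonzero `T`-submodules of `N i` meet the essential submodule `V` nontrivially, and within the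
  -- uniform module `V` these intersections meet.
  by_contra hL0
  refine hcrit.inf_ne_bot (hr L hL0) (hr U hU.1) (eq_bot_iff.2 ?_)
  rintro v ⟨hvL, hvU⟩
  have : (⟨v.1.1, v.1.2⟩ : N' i) ∈ L ⊓ LinearMap.range U.subtype := by
    rw [Submodule.range_subtype]
    exact ⟨hvL, hvU⟩
  rw [hL, Submodule.mem_bot] at this
  exact Subtype.ext (Subtype.ext (congrArg Subtype.val this))

end Setting

/-! ### The action of `θ`. -/

section Setting

variable {k : Type v} [Field k] {R : Type u} [CommRing R] [IsDomain R] [Algebra k R]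
  {α : R ≃ₐ[k] R}

theorem theta_smul_eq_zero_of_simple {V : Type w} [AddCommGroup V]
    [Module (RingS α)ᵐᵒᵖ V]
    [IsSimpleModule (RingS α)ᵐᵒᵖ V] [FaithfulSMul (RingS α)ᵐᵒᵖ V] (v : V)
    (hv : op (SkewPoly.theta (α : R ≃+* R)) • v = 0) : v = 0 := by
  have hinj := (bijective_smul_of_normal (V := V) (x := op (SkewPoly.theta (α : R ≃+* R)))
    (by simpa using SkewPoly.theta_ne_zero)
    (fun a => by
      obtain ⟨g, hg⟩ := SkewPoly.exists_mul_theta (unop a)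
      exact ⟨op g, unop_injective hg⟩)
    (fun a => by
      obtain ⟨g, hg⟩ := SkewPoly.exists_theta_mul (unop a)
      exact ⟨op g, unop_injective hg⟩)).1
  exact hinj (hv.trans (smul_zero _).symm)

omit [IsDomain R] in
-- Normality of `θ` makes its kernel a `T`-submodule; it meets `V` trivially and so vanishes.
theorem theta_smul_eq_zero_of_essential {V E : Type w} [AddCommGroup V]
    [Module (RingT α)ᵐᵒᵖ V]
    [AddCommGroup E] [Module (RingT α)ᵐᵒᵖ E] {j : V →ₗ[(RingT α)ᵐᵒᵖ] E}
    (hj : IsInjectiveHull (RingT α)ᵐᵒᵖ j)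
    (hV : ∀ v : V, op (SkewPoly.theta (fracAut α)) • v = 0 → v = 0) (e : E)
    (he : op (SkewPoly.theta (fracAut α)) • e = 0) : e = 0 := by
  let K : Submodule (RingT α)ᵐᵒᵖ E :=
    { carrier := {e | op (SkewPoly.theta (fracAut α)) • e = 0}
      zero_mem' := smul_zero _
      add_mem' := fun {a b} ha hb => by
        rw [Set.mem_ofPred_eq, smul_add, ha, hb, add_zero]
      smul_mem' := fun b e he => by
        obtain ⟨g, hg⟩ := SkewPoly.exists_mul_theta (unop b)
        have hbt : op (SkewPoly.theta (fracAut α)) * b = op g * op (SkewPoly.theta (fracAut α)) :=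
          unop_injective hg
        rw [Set.mem_ofPred_eq, ← mul_smul, hbt, mul_smul, he, smul_zero] }
  have hK : K = ⊥ := hj.2.2 K (by
    rw [eq_bot_iff]
    rintro _ ⟨hv, v, rfl⟩
    have hv' : op (SkewPoly.theta (fracAut α)) • j v = 0 := hv
    rw [← map_smul, map_eq_zero_iff j hj.2.1] at hv'
    rw [hV v hv', map_zero]
    exact zero_mem _)
  have : e ∈ K := he
  rwa [hK, Submodule.mem_bot] at this

/-- Modulo `X` everything commutes and `θ` cancels; hence `𝒞` is stable under moving its elements
past `θ`. -/
theorem red_eq_one_of_theta_mul [IsDiscreteValuationRing R]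
    (h : ∀ r, IsLocalRing.residue R ((α : R ≃+* R) r) = IsLocalRing.residue R r) {c c' : RingS α} (hc : SkewPoly.red h c = 1)
    (hcc : SkewPoly.theta (α : R ≃+* R) * c = c' * SkewPoly.theta (α : R ≃+* R)) :
    SkewPoly.red h c' = 1 := by
  have := congrArg (SkewPoly.red h) hcc
  rw [map_mul, map_mul, hc, SkewPoly.red_theta, mul_comm] at this
  exact (mul_right_cancel₀ Polynomial.X_ne_zero this).symm

end Setting

end

theorem mainTheorem10 {k : Type v} [Field k] {R : Type u} [CommRing R] [IsDomain R]
    [IsDiscreteValuationRing R] [Algebra k R]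
    (hk : Function.Bijective (algebraMap k (IsLocalRing.ResidueField R)))
    (X : R) (hX : IsLocalRing.maximalIdeal R = Ideal.span {X})
    (α : R ≃ₐ[k] R) (hα : ¬ IsOfFinOrder α) :
    -- `𝒞` is an `α`-invariant (left and right) Ore set
    (autS α '' setC α X = setC α X ∧
      ∃ M : Submonoid (RingS α), (M : Set (RingS α)) = setC α X ∧
        Nonempty (OreLocalization.OreSet M) ∧ Nonempty (OreLocalization.OreSet M.op)) ∧
    -- irreducible factors of elements of `𝒞` are of type (B)
    (∀ c ∈ setC α X, ∀ l : List (RingS α), (∀ z ∈ l, Irreducible z) → l.prod = c →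
      ∀ z ∈ l, IsTypeB α X z) ∧
    ∀ (V : Type u) [AddCommGroup V] [Module (RingS α)ᵐᵒᵖ V]
      [IsSimpleModule (RingS α)ᵐᵒᵖ V] [FaithfulSMul (RingS α)ᵐᵒᵖ V],
      -- `V` is a `T`-module, and `E` denotes its injective hull as a `T`-module
      (∃ _ : Module (RingT α)ᵐᵒᵖ V, ExtendsAction α V) ∧
      ∀ [Module (RingT α)ᵐᵒᵖ V], ExtendsAction α V →
      ∀ (E : Type u) [AddCommGroup E] [Module (RingT α)ᵐᵒᵖ E] (j : V →ₗ[(RingT α)ᵐᵒᵖ] E),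
        IsInjectiveHull (RingT α)ᵐᵒᵖ j →
        -- the `𝒞`-torsion elements form a nonzero `T`-submodule `W`
        ∃ W : Submodule (RingT α)ᵐᵒᵖ E,
          (W : Set E) = {e | ∃ c ∈ setC α X, op (inclST α c) • e = 0} ∧ W ≠ ⊥ ∧
          -- `W` is locally Artinian over `S`, with composition factors of type (B)
          IsLocallyArtinian (RingS α)ᵐᵒᵖ (AsS α W) ∧
          (∀ A B : Submodule (RingS α)ᵐᵒᵖ (AsS α W), A ≤ B →
            IsSimpleModule (RingS α)ᵐᵒᵖ (B ⧸ A.submoduleOf B) →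
            IsTypeBModule α X (B ⧸ A.submoduleOf B)) ∧
          -- the structure of `E / W`
          (Nontrivial (E ⧸ W) →
            (∀ x : E ⧸ W, ∀ c ∈ setC α X, op (inclST α c) • x = 0 → x = 0) ∧
            Module.Injective (RingT α)ᵐᵒᵖ (E ⧸ W) ∧
            Module.Injective (RingS α)ᵐᵒᵖ (AsS α (E ⧸ W)) ∧
            (∃ (ι : Type u) (N : ι → Submodule (RingS α)ᵐᵒᵖ (AsS α (E ⧸ W))),
              IsTypeCDecomposition α X N) ∧
            (∀ (ι : Type u) (N : ι → Submodule (RingS α)ᵐᵒᵖ (AsS α (E ⧸ W))),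
              IsTypeCDecomposition α X N →
              ∃ N' : ι → Submodule (RingT α)ᵐᵒᵖ (E ⧸ W),
                (∀ i x, x ∈ N' i ↔ Restrict.of (RingHom.op (inclST α)) (E ⧸ W) x ∈ N i) ∧
                IsSimpleHullDecomposition N')) := by

  have hres := residue_aut (α := α) hk.2
  have H := isNormalLocalization hres hX
  have hred : ∀ c, c ∈ setC α X ↔ redOp hres (op c) = 1 := mem_setC_iff hres hX
  refine ⟨⟨autS_image_setC hres hX, exists_submonoid_setC hres hX⟩,
    fun c hc l hl hlc => isTypeB_of_prod_mem hres hX hc l hl hlc, fun V _ _ _ _ => ?_⟩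
  have hbij : Function.Bijective fun v : V => op (SkewPoly.const (α : R ≃+* R) X) • v :=
    bijective_smul_of_normal H.ne_zero H.mul_comm_left H.mul_comm_right
  refine ⟨?_, fun hExt E _ _ j hj => ?_⟩
  · obtain ⟨inst, hinst⟩ := H.exists_module hbij
    exact ⟨inst, fun s v => hinst (op s) v⟩
  let ι := RingHom.op (inclST α)
  have hιC : ∀ c, redOp hres c = 1 → ι c ≠ 0 := fun c hc h0 => by
    rw [map_eq_zero_iff _ H.injective] at h0
    rw [h0, map_zero] at hc
    exact zero_ne_one hc
  have hdivE : ∀ b : (RingT α)ᵐᵒᵖ, b ≠ 0 → ∀ e : E, ∃ e', b • e' = e := fun b hb e =>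
    exists_smul_eq_of_injective hj.1 hb e
  have htorV : ∀ v : V, ∃ c, redOp hres c = 1 ∧ ι c • v = 0 := fun v => by
    obtain ⟨c, hc, hcv⟩ := H.exists_smul_eq_zero_of_simple hbij.2 v
    exact ⟨c, hc, (hExt (unop c) v).trans hcv⟩
  -- A nonzero element has a nonzero multiple in `V` by essentiality, and `V` is killed elementwise
  -- by `𝒞`.
  have htorE : ∀ e : E, ∃ b : (RingT α)ᵐᵒᵖ, b ≠ 0 ∧ b • e = 0 := fun e => by
    by_cases he : e = 0
    · exact ⟨1, one_ne_zero, by rw [he, smul_zero]⟩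
    have hne : Submodule.span (RingT α)ᵐᵒᵖ {e} ⊓ LinearMap.range j ≠ ⊥ := fun h0 =>
      he (Submodule.span_singleton_eq_bot.1 (hj.2.2 _ h0))
    obtain ⟨y, ⟨hye, v, rfl⟩, hy⟩ := Submodule.exists_mem_ne_zero_of_ne_bot hne
    obtain ⟨b, hb⟩ := Submodule.mem_span_singleton.1 hye
    obtain ⟨c, hc, hcv⟩ := htorV v
    refine ⟨ι c * b, mul_ne_zero (hιC c hc) ?_, ?_⟩
    · rintro rfl
      exact hy (by rw [← hb, zero_smul])
    · rw [mul_smul, hb, ← map_smul, hcv, map_zero]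
  let W := H.torsionSubmodule (ore_setC hres hX) E
  have hWmem : ∀ {e}, e ∈ W ↔ ∃ c, redOp hres c = 1 ∧ ι c • e = 0 := Iff.rfl
  have hWtor : ∀ y : W, ∃ c, redOp hres c = 1 ∧ ι c • y = 0 := fun y => by
    obtain ⟨c, hc, hcy⟩ := hWmem.1 y.2
    exact ⟨c, hc, Subtype.ext hcy⟩
  refine ⟨W, ?_, ?_, H.isLocallyArtinian (chainsStabilize_ringT α) hWtor, ?_, fun _ => ?_⟩
  · ext e
    constructor
    · rintro ⟨c, hc, hce⟩
      exact ⟨unop c, (hred _).2 hc, hce⟩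
    · rintro ⟨c, hc, hce⟩
      exact ⟨op c, (hred _).1 hc, hce⟩
  · have := IsSimpleModule.nontrivial (RingS α)ᵐᵒᵖ V
    obtain ⟨v, hv⟩ := exists_ne (0 : V)
    intro hW
    have hjv : j v ∈ W := by
      obtain ⟨c, hc, hcv⟩ := htorV v
      exact ⟨c, hc, by rw [← map_smul]; exact (congrArg j hcv).trans (map_zero j)⟩
    rw [hW, Submodule.mem_bot, map_eq_zero_iff j hj.2.1] at hjv
    exact hv hjv
  · intro A B _ _
    refine isTypeBModule_of_torsion hres hX fun d => ?_
    obtain ⟨y, rfl⟩ := Submodule.Quotient.mk_surjective _ d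
    obtain ⟨c, hc, hcy⟩ := hWtor y.1
    refine ⟨c, hc, ?_⟩
    rw [← Submodule.Quotient.mk_smul]
    have : c • y = 0 := Subtype.ext hcy
    rw [this, Submodule.Quotient.mk_zero]
  · have hC : ∀ (y : E ⧸ W) (c : (RingS α)ᵐᵒᵖ), redOp hres c = 1 → ι c • y = 0 → y = 0 := by
      intro y c hc hcy
      obtain ⟨e, rfl⟩ := Submodule.Quotient.mk_surjective _ y
      rw [← Submodule.Quotient.mk_smul, Submodule.Quotient.mk_eq_zero] at hcy
      obtain ⟨d, hd, hde⟩ := hWmem.1 hcy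
      rw [Submodule.Quotient.mk_eq_zero]
      exact hWmem.2 ⟨d * c, by rw [map_mul, hd, hc, one_mul], by rw [map_mul, mul_smul, hde]⟩
    have hdivF : ∀ b : (RingT α)ᵐᵒᵖ, b ≠ 0 → ∀ y : E ⧸ W, ∃ y', b • y' = y := fun b hb y => by
      obtain ⟨e, rfl⟩ := Submodule.Quotient.mk_surjective _ y
      obtain ⟨e', rfl⟩ := hdivE b hb e
      exact ⟨Submodule.Quotient.mk e', rfl⟩
    have htorF : ∀ y : E ⧸ W, ∃ b : (RingT α)ᵐᵒᵖ, b ≠ 0 ∧ b • y = 0 := fun y => by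
      obtain ⟨e, rfl⟩ := Submodule.Quotient.mk_surjective _ y
      obtain ⟨b, hb, hbe⟩ := htorE e
      exact ⟨b, hb, by rw [← Submodule.Quotient.mk_smul, hbe, Submodule.Quotient.mk_zero]⟩
    have hιθ : ι (op (SkewPoly.theta (α : R ≃+* R))) = op (SkewPoly.theta (fracAut α)) :=
      congrArg op inclST_theta
    have hθE : ∀ e : E, op (SkewPoly.theta (fracAut α)) • e = 0 → e = 0 :=
      theta_smul_eq_zero_of_essential hj fun v hv => theta_smul_eq_zero_of_simple (α := α) v (by
        rw [← hExt, inclST_theta, hv])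
    -- If `c` kills `θ e`, then `c θ = θ g` with `g` again in `𝒞`; injectivity of `θ` on `E` shows
    -- that `g` kills `e`.
    have hθF : ∀ y : E ⧸ W, ι (op (SkewPoly.theta (α : R ≃+* R))) • y = 0 → y = 0 := by
      intro y hy
      obtain ⟨e, rfl⟩ := Submodule.Quotient.mk_surjective _ y
      rw [← Submodule.Quotient.mk_smul, Submodule.Quotient.mk_eq_zero] at hy
      obtain ⟨c, hc, hce⟩ := hWmem.1 hy
      obtain ⟨g, hg⟩ := SkewPoly.exists_theta_mul (unop c)
      have hcθ : c * op (SkewPoly.theta (α : R ≃+* R)) =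
        op (SkewPoly.theta (α : R ≃+* R)) * op g := unop_injective hg
      rw [← mul_smul, ← map_mul, hcθ, map_mul, mul_smul, hιθ] at hce
      rw [Submodule.Quotient.mk_eq_zero]
      exact hWmem.2 ⟨op g, red_eq_one_of_theta_mul hres hc hg, hθE _ hce⟩
    refine ⟨fun y c hc hcy => hC y (op c) ((hred c).1 hc) hcy,
      injective_of_divisible_of_isPrincipalIdealRing hdivF, injective_asS hres hX hdivF, ?_,
      fun κ N hN => exists_isSimpleHullDecomposition hres hX htorF N hN⟩
    obtain ⟨𝒮, hind, htop, hhull⟩ := exists_decomposition hdivF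
      fun K hK => exists_isAtom_le (chainsStabilize_ringT α) htorF K hK
    refine ⟨𝒮, fun N => N.1.restrict ι, (isDirectSumOf_restrict ι fun N : 𝒮 => N.1).2
      ⟨(sSupIndep_iff 𝒮).1 hind, (sSup_eq_iSup' 𝒮).symm.trans htop⟩, fun N => ?_⟩
    exact exists_isTypeCCritical hres hX hk.2 htorF hC hθF (hhull N N.2).1 (hhull N N.2).2
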